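/- Let $n\ge 2$ and $s>\frac n2$. Fix a smooth cutoff $\chi:\mathbb R^n\to\mathbb R$ with $\chi=1$ on $\{|\xi|\le 1\}$ and $\chi=0$ on $\{|\xi|\ge 2\}$. For a tempered distribution $u$ on $\mathbb R^n$ with values in $\mathbb C^m$ and $\lambda=2^j$, $j\ge 0$, set $u_{\le\lambda}=\chi(D/\lambda)u$ with $D=-i\nabla$, $u_1=u_{\le 1}$, and $u_\lambda=u_{\le\lambda}-u_{\le\lambda/2}$ for $\lambda\ge 2$. Define $$\|v\|_{\mathcal DL^2_\lambda}=\sup_{x_0\in\mathbb R^n}\ \sup_{\omega\in\mathbb S^{n-1}}\ \sum_{k\in\mathbb N}\big\|1_{\{|\lambda^{-1}(x-x_0)-k\omega|<1\}}\,v\big\|_{L^2},\qquad \|u\|_{\mathcal DH^s}^2=\sum_{\lambda=2^j,\ j\ge 0}\lambda^{2s}\|u_\lambda\|_{\mathcal DL^2_\lambda}^2 ,$$ and let $\mathcal DH^s$ be the set of all $u$ with $\|u\|_{\mathcal DH^s}<\infty$. For $u_0\in\mathcal DH^s$ put $M=\|u_0\|_{\mathcal DH^s}$, and for $\varepsilon>0$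 let $u_0^\varepsilon(x)=\varepsilon u_0(\varepsilon x)$, with low-frequency part $u^\varepsilon_{0,\le 1}=\chi(D)u_0^\varepsilon$. Let $B_0:(\mathbb C^m\times\mathbb C^m)\times(\mathbb C^m)^n\to\mathbb C^m$ be a complex bilinear form, with norm $\|B_0\|$ taken with respect to the Euclidean norm on $\mathbb C^m$ and the maximum norms on the products, and let $a(x,\xi)=B_0\big((u^\varepsilon_{0,\le 1}(x),\overline{u^\varepsilon_{0,\le 1}(x)}),\xi\big)$, that is, the $m\times m$ matrix $v\mapsto B_0\big((u^\varepsilon_{0,\le 1}(x),\overline{u^\varepsilon_{0,\le 1}(x)}),(\xi_1v,\dots,\xi_nv)\big)$. Given constants $K=(K_{\alpha,\beta})$, $\kappa>0$ and $L\ge 0$, a symbol $a$ (possibly also depending, measurably, on $t$) belongs to $\mathcal C_L$ (relative to $K$ and $\kappa$) if it is smooth in $(x,\xi)$, if $$\sup_{x,\xi}\int_0^1|a(t,x+2t\xi,\xi)|\,dt\le L ,$$ and if for some $\delta\ge 0$ with $\delta e^{L}\le\kappa$ $$\sup_{x,\xi}\int_0^1|\partial_x^\alpha\partial_\xi^\beta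 a(t,x+2t\xi,\xi)|\,dt\le K_{\alpha,\beta}\,\delta\qquad\text{for all multi-indices with } |\alpha|+|\beta|\ge 1 .$$ Then there are $c>0$ and $K=(K_{\alpha,\beta})$, depending only on $n$, $s$ and $\chi$, such that for all $m$, all $B_0$ and all $\kappa>0$ there is $C>0$ with the following property: for every $u_0\in\mathcal DH^s$ and every $0<\varepsilon\le e^{-CM}$, the symbol $a$ belongs to $\mathcal C_{c\|B_0\|M}$ relative to $K$ and $\kappa$. -/

import Mathlib

open MeasureTheory
open scoped ENNReal NNReal SchwartzMap FourierTransform ContDiff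

noncomputable section

namespace DerivNLS

/-- Physical space `ℝⁿ`. -/
abbrev Space (n : ℕ) : Type := EuclideanSpace ℝ (Fin n)

/-- The values `ℂᵐ` of the unknown. -/
abbrev Val (m : ℕ) : Type := EuclideanSpace ℂ (Fin m)

/-- Componentwise complex conjugation on `ℂᵐ`. -/
def conjVal {m : ℕ} (v : Val m) : Val m := WithLp.toLp 2 fun i => star (v i)

/-! ### Littlewood-Paley decomposition of tempered distributions -/

/-- A smooth frequency cutoff: equal to `1` for `|ξ| ≤ 1` and to `0` for `|ξ| ≥ 2`. -/
structure Cutoff (n : ℕ) where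
  toFun : Space n → ℝ
  smooth : ContDiff ℝ ∞ toFun
  eq_one : ∀ ξ, ‖ξ‖ ≤ 1 → toFun ξ = 1
  eq_zero : ∀ ξ, 2 ≤ ‖ξ‖ → toFun ξ = 0

namespace Cutoff

variable {n m : ℕ} (χ : Cutoff n)

/-- The multiplier of `χ(D / 2^j)`, `D = -i∂`. Mathlib's Fourier variable `η` corresponds to the
frequency `ξ = 2πη`. -/
def multiplier (j : ℕ) (η : Space n) : ℂ := (χ.toFun ((2 * Real.pi / 2 ^ j : ℝ) • η) : ℂ)

lemma contDiff_multiplier (j : ℕ) : ContDiff ℝ ∞ (χ.multiplier j) :=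
  Complex.ofRealCLM.contDiff.comp (χ.smooth.comp (contDiff_const_smul _))

lemma hasCompactSupport_multiplier (j : ℕ) : HasCompactSupport (χ.multiplier j) := by
  have hpos : (0 : ℝ) < 2 * Real.pi / 2 ^ j := by positivity
  refine HasCompactSupport.intro
    (isCompact_closedBall (0 : Space n) (2 / (2 * Real.pi / 2 ^ j))) fun η hη => ?_
  have h1 : 2 / (2 * Real.pi / 2 ^ j) < ‖η‖ := by simpa using hη
  have h2 : 2 ≤ ‖(2 * Real.pi / 2 ^ j : ℝ) • η‖ := by
    rw [norm_smul, Real.norm_of_nonneg hpos.le, mul_comm]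
    exact ((div_lt_iff₀ hpos).1 h1).le
  simp [multiplier, χ.eq_zero _ h2]

/-- The convolution kernel of `χ(D / 2^j)`. -/
def kernel (j : ℕ) : 𝓢(Space n, ℂ) :=
  𝓕⁻ ((χ.hasCompactSupport_multiplier j).toSchwartzMap (χ.contDiff_multiplier j))

/-- The Schwartz function `y ↦ K(x - y)`. -/
def reflectAt (K : 𝓢(Space n, ℂ)) (x : Space n) : 𝓢(Space n, ℂ) :=
  SchwartzMap.compSubConstCLM ℂ x
    (SchwartzMap.compCLMOfContinuousLinearEquiv ℂ (ContinuousLinearEquiv.neg ℝ) K)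

lemma reflectAt_apply (K : 𝓢(Space n, ℂ)) (x y : Space n) : reflectAt K x y = K (x - y) := by
  simp [reflectAt]

/-- `u_{≤ 2^j} = χ(D / 2^j) u`, the convolution of the tempered distribution `u` with the kernel,
which is a function: `x ↦ ⟨u, K(x - ·)⟩`. -/
def low (j : ℕ) (u : 𝓢'(Space n, Val m)) (x : Space n) : Val m :=
  u (reflectAt (χ.kernel j) x)

/-- The dyadic piece `u_λ`, `λ = 2^j`; all frequencies smaller than `1` are included in `u_1`. -/
def block : ℕ → 𝓢'(Space n, Val m) → Space n → Val m
  | 0, u, x => χ.low 0 u x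
  | j + 1, u, x => χ.low (j + 1) u x - χ.low j u x

end Cutoff

/-! ### The spaces with decay along lines -/

/-- The norm `𝒟L²_l`:
`sup_{x₀} sup_{|θ| = 1} ∑_{k ∈ ℕ} ‖1_{|l⁻¹ (x - x₀) - k θ| < 1} v‖_{L²}`. -/
def dlNorm {n m : ℕ} (l : ℝ) (v : Space n → Val m) : ℝ≥0∞ :=
  ⨆ (x₀ : Space n) (θ : Space n) (_ : ‖θ‖ = 1), ∑' k : ℕ,
    eLpNorm ({x : Space n | ‖l⁻¹ • (x - x₀) - (k : ℝ) • θ‖ < 1}.indicator v) 2 volume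

/-- The norm `𝒟Hˢ`: `‖u‖² = ∑_{λ = 2^j, j ≥ 0} λ^{2s} ‖u_λ‖²_{𝒟L²_λ}`. -/
def dhNorm {n m : ℕ} (χ : Cutoff n) (s : ℝ) (u : 𝓢'(Space n, Val m)) : ℝ≥0∞ :=
  (∑' j : ℕ, ENNReal.ofReal (((2 : ℝ) ^ j) ^ (2 * s)) * dlNorm (2 ^ j) (χ.block j u) ^ 2)
    ^ (1 / 2 : ℝ)

/-- `u ∈ 𝒟Hˢ`. -/
def MemDH {n m : ℕ} (χ : Cutoff n) (s : ℝ) (u : 𝓢'(Space n, Val m)) : Prop :=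
  dhNorm χ s u < ⊤

/-! ### Scaling -/

/-- The substitution `φ ↦ φ(ε⁻¹ ·)` on Schwartz functions. -/
def dilate {n : ℕ} (ε : ℝ) (hε : 0 < ε) : 𝓢(Space n, ℂ) →L[ℂ] 𝓢(Space n, ℂ) :=
  SchwartzMap.compCLMOfContinuousLinearEquiv ℂ
    (ContinuousLinearEquiv.smulLeft (Units.mk0 ε⁻¹ (inv_ne_zero hε.ne')) :
      Space n ≃L[ℝ] Space n)

lemma dilate_apply {n : ℕ} (ε : ℝ) (hε : 0 < ε) (φ : 𝓢(Space n, ℂ)) (x : Space n) :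
    dilate ε hε φ x = φ (ε⁻¹ • x) := rfl

/-- The rescaled distribution `u^ε(x) = ε u(ε x)`, that is
`⟨u^ε, φ⟩ = ε ε⁻ⁿ ⟨u, φ(ε⁻¹ ·)⟩`. -/
def rescale {n m : ℕ} (ε : ℝ) (hε : 0 < ε) (u : 𝓢'(Space n, Val m)) : 𝓢'(Space n, Val m) :=
  ((ε * (ε ^ n)⁻¹ : ℝ) : ℂ) • PointwiseConvergenceCLM.precomp (Val m) (dilate ε hε) u

/-! ### The symbol -/

/-- A bilinear form `B₀((u, ū), ∇u)`, bilinear over `ℂ` in `(u, ū) ∈ ℂᵐ × ℂᵐ` and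
`∇u ∈ (ℂᵐ)ⁿ`, with values in `ℂᵐ`. -/
abbrev GradForm (n m : ℕ) : Type := (Val m × Val m) →L[ℂ] (Fin n → Val m) →L[ℂ] Val m

/-- The matrix `B₀((w, w̄), ξ)`: it maps `v ∈ ℂᵐ` to `B₀((w, w̄), (ξ₁ v, …, ξₙ v))`. -/
def formSymbol {n m : ℕ} (B₀ : GradForm n m) (w : Val m) (ξ : Space n) : Val m →L[ℂ] Val m :=
  (B₀ (w, conjVal w)).comp
    (ContinuousLinearMap.pi fun j => ((ξ j : ℝ) : ℂ) • ContinuousLinearMap.id ℂ (Val m))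

/-- The symbol `a(x, ξ) = B₀((u^ε_{≤ 1}(x), conj u^ε_{≤ 1}(x)), ξ)`. -/
def lowSymbol {n m : ℕ} (χ : Cutoff n) (B₀ : GradForm n m) (ε : ℝ) (hε : 0 < ε)
    (u : 𝓢'(Space n, Val m)) (x ξ : Space n) : Val m →L[ℂ] Val m :=
  formSymbol B₀ (χ.low 0 (rescale ε hε u) x) ξ

/-! ### The symbol class -/

section SymbolClass

variable {n : ℕ} {G : Type*} [NormedAddCommGroup G] [NormedSpace ℝ G]

/-- The partial derivative `∂_{x_i}` of `g(x, ξ)`. -/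
def partialX (i : Fin n) (g : Space n → Space n → G) (x ξ : Space n) : G :=
  fderiv ℝ (fun y => g y ξ) x (EuclideanSpace.single i 1)

/-- The partial derivative `∂_{ξ_i}` of `g(x, ξ)`. -/
def partialXi (i : Fin n) (g : Space n → Space n → G) (x ξ : Space n) : G :=
  fderiv ℝ (fun η => g x η) ξ (EuclideanSpace.single i 1)

/-- `∂_x^α ∂_ξ^β g`. -/
def mixedDeriv (α β : Fin n → ℕ) (g : Space n → Space n → G) : Space n → Space n → G :=
  (List.finRange n).foldr (fun i h => (partialX i)^[α i] h)
    ((List.finRange n).foldr (fun i h => (partialXi i)^[β i] h) g)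

/-- The class `𝒞_M`, relative to the constants `K α β` and to a number `κ > 0` that
quantifies the requirement `δ e^M ≪ 1` as `δ e^M ≤ κ`. -/
structure InClass (K : (Fin n → ℕ) → (Fin n → ℕ) → ℝ) (κ M : ℝ)
    (a : ℝ → Space n → Space n → G) : Prop where
  measurable : ∀ x ξ, StronglyMeasurable fun t => a t x ξ
  smooth : ∀ t, ContDiff ℝ ∞ fun p : Space n × Space n => a t p.1 p.2
  bound : ∀ x ξ, ∫⁻ t in Set.Icc (0 : ℝ) 1, ‖a t (x + (2 * t) • ξ) ξ‖ₑ ≤ ENNReal.ofReal M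
  deriv_bound : ∃ δ : ℝ, 0 ≤ δ ∧ δ * Real.exp M ≤ κ ∧
    ∀ α β : Fin n → ℕ, 1 ≤ ∑ i, α i + ∑ i, β i → ∀ x ξ,
      ∫⁻ t in Set.Icc (0 : ℝ) 1, ‖mixedDeriv α β (a t) (x + (2 * t) • ξ) ξ‖ₑ
        ≤ ENNReal.ofReal (K α β * δ)

end SymbolClass

end DerivNLS

end

/-! By scaling, `u^ε_{≤1}(x) = ε w(εx)`, where `w` is the part of `u₀` with frequencies `|ξ| ≤ 2/ε`,
so only dyadic blocks with `λ = 2^j ≤ 4/ε` contribute. The core estimate bounds a block along any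
unit-speed half-line: `∫ |u_λ(y + rθ)| dr ≲ λ^{n/2} ‖u_λ‖_{𝒟L²_λ}`. Indeed `|u_λ|` is dominated by
its averages at scale `1/λ`. On a segment of length `λ` these averages see a tube of radius about
`1/λ` inside a ball of radius `λ`, so Cauchy-Schwarz costs only `λ^{n/2}`, and summing over segments
produces the sum over `k` in `dlNorm` (`lintegral_ballAverage_le`). Since `s > n/2`, the sum over
`λ` converges and is at most a constant times `M`.

The ray `t ↦ ε(x + 2tξ)` has speed `2ε|ξ|`. Changing variables cancels both the factor `|ξ|` of the
symbol and the amplitude `ε` (`lintegral_along_ray_le`), which gives the bound `c‖B₀‖M`.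

An `x`-derivative of order `q` costs `(ελ)^q`. As `ελ ≤ 4`, this is at most a constant times
`(ελ)^σ` for `0 ≤ σ ≤ q`. Half of the surplus `s - n/2 = 2ρ` pays for `λ^σ`, the other half keeps
the sum convergent, and a gain `ε^σ` with `σ = min 1 ρ` remains (`dyadic_weight_le`). One
`ξ`-derivative removes the factor `|ξ|`; then the pointwise bound `|∂^α u^ε_{≤1}| ≲ εM` on a unit
time interval suffices. Two `ξ`-derivatives vanish, the symbol being linear in `ξ`. Hence `δ = ‖B₀‖
M ε^σ` works, and `ε ≤ e^{-CM}` beats the exponential (`smallness`).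

As `u₀` is only a tempered distribution, smoothness of `u₀ * K` and associativity of convolution
rest on `apply_eq_integral`, which moves a continuous functional inside an integral of Schwartz
functions. -/

noncomputable section

namespace DerivNLS

open scoped BoundedContinuousFunction LineDeriv

/-! ### Integrals of Schwartz-valued maps under continuous linear maps -/

section SchwartzIntegral

variable {E F : Type*} [NormedAddCommGroup E] [NormedSpace ℝ E]
  [NormedAddCommGroup F] [NormedSpace ℂ F]

/-- Bounded continuous functions with values in `l`-linear forms. -/
def BddForms (E : Type*) [NormedAddCommGroup E] [NormedSpace ℝ E] (l : ℕ) : Type _ :=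
  E →ᵇ (E [×l]→L[ℝ] ℂ)

instance (l : ℕ) : NormedAddCommGroup (BddForms E l) :=
  inferInstanceAs (NormedAddCommGroup (E →ᵇ (E [×l]→L[ℝ] ℂ)))

instance (l : ℕ) : NormedSpace ℂ (BddForms E l) :=
  inferInstanceAs (NormedSpace ℂ (E →ᵇ (E [×l]→L[ℝ] ℂ)))

instance (l : ℕ) : CompleteSpace (BddForms E l) :=
  inferInstanceAs (CompleteSpace (E →ᵇ (E [×l]→L[ℝ] ℂ)))

namespace BddForms

/-- Evaluation of a bounded form-valued function at a point and at vectors. -/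
def eval {l : ℕ} (x : E) (m : Fin l → E) : BddForms E l →L[ℂ] ℂ :=
  LinearMap.mkContinuous
    { toFun := fun f => (show E →ᵇ (E [×l]→L[ℝ] ℂ) from f) x m
      map_add' := fun _ _ => rfl
      map_smul' := fun _ _ => rfl } (∏ i, ‖m i‖) fun f => by
    refine (ContinuousMultilinearMap.le_opNorm _ m).trans ?_
    rw [mul_comm]
    exact mul_le_mul_of_nonneg_left (BoundedContinuousFunction.norm_coe_le_norm
      (show E →ᵇ (E [×l]→L[ℝ] ℂ) from f) x) (Finset.prod_nonneg fun _ _ => norm_nonneg _)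

lemma ext_eval {l : ℕ} {f g : BddForms E l} (h : ∀ x m, eval x m f = eval x m g) : f = g :=
  BoundedContinuousFunction.ext fun x => ContinuousMultilinearMap.ext fun m => h x m

end BddForms

/-- The bounded continuous function `x ↦ ‖x‖ ^ k • D^l φ(x)` attached to a Schwartz function. -/
def weightedDeriv (k l : ℕ) (φ : 𝓢(E, ℂ)) : BddForms E l :=
  BoundedContinuousFunction.ofNormedAddCommGroup
    (fun x => ‖x‖ ^ k • iteratedFDeriv ℝ l φ x)
    ((continuous_norm.pow k).smul ((φ.smooth ⊤).continuous_iteratedFDeriv (mod_cast le_top)))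
    (SchwartzMap.seminorm ℂ k l φ) fun x => by
      rw [norm_smul, norm_pow, norm_norm]
      exact SchwartzMap.le_seminorm ℂ k l φ x

lemma eval_weightedDeriv (k l : ℕ) (φ : 𝓢(E, ℂ)) (x : E) (m : Fin l → E) :
    BddForms.eval x m (weightedDeriv k l φ) = ‖x‖ ^ k • (∂^{m} φ) x := by
  rw [SchwartzMap.iteratedLineDerivOp_eq_iteratedFDeriv]; rfl

lemma norm_weightedDeriv (k l : ℕ) (φ : 𝓢(E, ℂ)) :
    ‖weightedDeriv k l φ‖ = SchwartzMap.seminorm ℂ k l φ := by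
  refine le_antisymm (BoundedContinuousFunction.norm_ofNormedAddCommGroup_le _
    (apply_nonneg _ _) _) ?_
  refine SchwartzMap.seminorm_le_bound ℂ k l φ (norm_nonneg (weightedDeriv k l φ)) fun x => ?_
  have h : ‖‖x‖ ^ k • iteratedFDeriv ℝ l φ x‖ ≤ ‖weightedDeriv k l φ‖ :=
    BoundedContinuousFunction.norm_coe_le_norm
      (show E →ᵇ (E [×l]→L[ℝ] ℂ) from weightedDeriv k l φ) x
  rwa [norm_smul, norm_pow, norm_norm] at h

/-- `weightedDeriv` as a continuous linear map. -/
def weightedDerivCLM (k l : ℕ) : 𝓢(E, ℂ) →L[ℂ] BddForms E l :=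
  SchwartzMap.mkCLMtoNormedSpace (𝕜 := ℂ) (weightedDeriv k l)
    (fun f g => BddForms.ext_eval fun x m => by
      simp only [map_add, eval_weightedDeriv, LineDeriv.iteratedLineDerivOp_add,
        add_apply, smul_add])
    (fun a f => BddForms.ext_eval fun x m => by
      simp only [map_smul, eval_weightedDeriv, LineDeriv.iteratedLineDerivOp_smul,
        smul_apply, RingHom.id_apply]
      rw [smul_comm])
    ⟨{(k, l)}, 1, zero_le_one, fun f => by simp [norm_weightedDeriv]⟩

/-- A continuous map on Schwartz space is bounded by finitely many Schwartz seminorms. -/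
lemma exists_norm_le_sum_seminorm (u : 𝓢(E, ℂ) →L[ℂ] F) :
    ∃ (s : Finset (ℕ × ℕ)) (C : ℝ), 0 ≤ C ∧
      ∀ φ, ‖u φ‖ ≤ C * ∑ i ∈ s, SchwartzMap.seminorm ℂ i.1 i.2 φ := by
  obtain ⟨s, C, -, h⟩ := Seminorm.bound_of_continuous (schwartz_withSeminorms ℂ E ℂ)
    ((normSeminorm ℂ F).comp u.toLinearMap) (continuous_norm.comp u.continuous)
  refine ⟨s, C, C.2, fun φ => (h φ).trans ?_⟩
  rw [smul_apply, NNReal.smul_def, smul_eq_mul]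
  refine mul_le_mul_of_nonneg_left ?_ C.2
  refine (Seminorm.finset_sup_le_sum _ s φ).trans_eq ?_
  simp [sum_apply, schwartzSeminormFamily]

/-- The embedding of Schwartz space with finitely many of its seminorms into a Banach space. -/
def weightedDerivPi (s : Finset (ℕ × ℕ)) :
    𝓢(E, ℂ) →L[ℂ] ((i : s) → BddForms E i.1.2) :=
  ContinuousLinearMap.pi fun i => weightedDerivCLM i.1.1 i.1.2

/-- Continuity involves finitely many seminorms, so the functional is bounded for the norm pulled
back from a Banach space, and Hahn-Banach extends it there. In that space the Bochner integral is
available. -/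
lemma exists_extend_weightedDerivPi (u : 𝓢(E, ℂ) →L[ℂ] ℂ) :
    ∃ (s : Finset (ℕ × ℕ)) (v : ((i : s) → BddForms E i.1.2) →L[ℂ] ℂ),
      ∀ φ, v (weightedDerivPi s φ) = u φ := by
  obtain ⟨s, C, hC, h⟩ := exists_norm_le_sum_seminorm u
  let ι := (weightedDerivPi (E := E) s).toLinearMap
  have hι : ∀ φ, ‖u φ‖ ≤ C * s.card * ‖ι φ‖ := fun φ => by
    refine (h φ).trans ?_
    rw [mul_assoc]
    refine mul_le_mul_of_nonneg_left ?_ hC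
    rw [← nsmul_eq_mul]
    refine Finset.sum_le_card_nsmul s _ _ fun i hi => ?_
    rw [← norm_weightedDeriv]
    exact norm_le_pi_norm (ι φ) ⟨i, hi⟩
  -- Any linear section `g` will do: by `hι`, `u` vanishes on the kernel of `ι`, so `u ∘ g` does not
  -- depend on the choice.
  obtain ⟨g, hg⟩ := ι.rangeRestrict.exists_rightInverse_of_surjective ι.range_rangeRestrict
  have hg' : ∀ y, ι (g y) = y := fun y =>
    congrArg Subtype.val (LinearMap.congr_fun hg y)
  let f₀ : StrongDual ℂ (LinearMap.range ι) :=
    (u.toLinearMap.comp g).mkContinuous (C * s.card) fun y => by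
      have := hι (g y)
      rw [hg' y] at this
      exact this
  obtain ⟨v, hv, -⟩ := exists_extension_norm_eq _ f₀
  refine ⟨s, v, fun φ => ?_⟩
  have h1 := hv ⟨ι φ, LinearMap.mem_range_self ι φ⟩
  have h2 : u (g ⟨ι φ, LinearMap.mem_range_self ι φ⟩ - φ) = 0 := by
    rw [← norm_le_zero_iff]
    refine (hι _).trans ?_
    rw [map_sub, hg']
    simp
  rw [map_sub, sub_eq_zero] at h2
  exact h1.trans h2

variable {T : Type*} [TopologicalSpace T]
  [SecondCountableTopology T] [MeasurableSpace T] [OpensMeasurableSpace T] {μ : Measure T}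

lemma integrable_of_seminorm (u : 𝓢(E, ℂ) →L[ℂ] F) {Ψ : T → 𝓢(E, ℂ)} (hΨ : Continuous Ψ)
    (hint : ∀ k l, Integrable (fun t => SchwartzMap.seminorm ℂ k l (Ψ t)) μ) :
    Integrable (fun t => u (Ψ t)) μ := by
  obtain ⟨s, C, hC, h⟩ := exists_norm_le_sum_seminorm u
  refine Integrable.mono' ((integrable_finsetSum s fun i _ => hint i.1 i.2).const_mul C)
    (u.continuous.comp hΨ).aestronglyMeasurable (.of_forall fun t => h _)

/-- Continuous linear maps on Schwartz space commute with integrals of Schwartz functions. -/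
theorem apply_eq_integral [CompleteSpace F] (u : 𝓢(E, ℂ) →L[ℂ] F) {Ψ : T → 𝓢(E, ℂ)}
    (hΨ : Continuous Ψ)
    (hint : ∀ k l, Integrable (fun t => SchwartzMap.seminorm ℂ k l (Ψ t)) μ) (Φ : 𝓢(E, ℂ))
    (hΦ : ∀ (l : ℕ) (m : Fin l → E) (x : E), (∂^{m} Φ) x = ∫ t, (∂^{m} (Ψ t)) x ∂μ) :
    u Φ = ∫ t, u (Ψ t) ∂μ := by
  -- Scalar functionals come first; the dual of `F` separates points, which gives the general case.
  have key : ∀ w : 𝓢(E, ℂ) →L[ℂ] ℂ, w Φ = ∫ t, w (Ψ t) ∂μ := by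
    intro w
    obtain ⟨s, v, hv⟩ := exists_extend_weightedDerivPi w
    have hi : Integrable (fun t => weightedDerivPi s (Ψ t)) μ := by
      refine Integrable.mono'
        (integrable_finsetSum s fun i _ => hint i.1 i.2)
        ((weightedDerivPi s).continuous.comp hΨ).aestronglyMeasurable (.of_forall fun t => ?_)
      refine (pi_norm_le_iff_of_nonneg (Finset.sum_nonneg fun i _ => apply_nonneg _ _)).2
        fun i => ?_
      change ‖weightedDeriv i.1.1 i.1.2 (Ψ t)‖ ≤ _
      rw [norm_weightedDeriv]
      exact Finset.single_le_sum
        (f := fun i : ℕ × ℕ => SchwartzMap.seminorm ℂ i.1 i.2 (Ψ t))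
        (fun i _ => apply_nonneg _ _) i.2
    simp_rw [← hv]
    rw [v.integral_comp_comm hi]
    congr 1
    -- The Bochner integral is identified with the image of `Φ` by point evaluations, which are
    -- continuous; there `hΦ` applies.
    refine funext fun i => BddForms.ext_eval fun x m => ?_
    have hΛ := ((BddForms.eval x m).comp (ContinuousLinearMap.proj (R := ℂ)
      (φ := fun i : s => BddForms E i.1.2) i)).integral_comp_comm hi
    refine Eq.trans ?_ hΛ
    change BddForms.eval x m (weightedDeriv i.1.1 i.1.2 Φ) =
      ∫ t, BddForms.eval x m (weightedDeriv i.1.1 i.1.2 (Ψ t)) ∂μ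
    simp_rw [eval_weightedDeriv]
    rw [integral_smul, hΦ]
  refine (SeparatingDual.eq_iff_forall_dual_eq (R := ℂ)).2 fun f => ?_
  rw [← f.integral_comp_comm (integrable_of_seminorm u hΨ hint)]
  exact key (f.comp u)

end SchwartzIntegral

end DerivNLS
end

noncomputable section

namespace DerivNLS

open scoped LineDeriv
open Cutoff

/-! ### Translates and reflections of Schwartz functions -/

section Reflect

variable {n : ℕ}

lemma lineDerivOp_reflectAt (K : 𝓢(Space n, ℂ)) (x v : Space n) :
    ∂_{v} (reflectAt K x) = -reflectAt (∂_{v} K) x := by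
  ext y
  have h1 : (reflectAt K x : Space n → ℂ) = fun y => K (x - y) :=
    funext fun y => reflectAt_apply K x y
  have h2 : HasFDerivAt (fun y => K (x - y)) (-(fderiv ℝ K (x - y))) y := by
    exact ((K.hasFDerivAt (x - y)).comp y ((hasFDerivAt_id y).const_sub x)).congr_fderiv (by simp)
  rw [SchwartzMap.lineDerivOp_apply_eq_fderiv, h1, h2.fderiv, neg_apply, neg_apply, reflectAt_apply,
    SchwartzMap.lineDerivOp_apply_eq_fderiv]

lemma reflectAt_smul (c : ℂ) (K : 𝓢(Space n, ℂ)) (x : Space n) :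
    reflectAt (c • K) x = c • reflectAt K x := by
  simp [reflectAt]

lemma reflectAt_sub (K L : 𝓢(Space n, ℂ)) (x : Space n) :
    reflectAt (K - L) x = reflectAt K x - reflectAt L x := by
  simp [reflectAt]

lemma iteratedLineDerivOp_reflectAt (K : 𝓢(Space n, ℂ)) (x : Space n) {l : ℕ}
    (m : Fin l → Space n) :
    ∂^{m} (reflectAt K x) = (-1 : ℂ) ^ l • reflectAt (∂^{m} K) x := by
  induction l with
  | zero => simp
  | succ l ih =>
    rw [LineDeriv.iteratedLineDerivOp_succ_left, ih, LineDeriv.lineDerivOp_smul,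
      lineDerivOp_reflectAt, LineDeriv.iteratedLineDerivOp_succ_left, pow_succ]
    simp

lemma iteratedFDeriv_reflectAt_norm (K : 𝓢(Space n, ℂ)) (x y : Space n) (l : ℕ) :
    ‖iteratedFDeriv ℝ l (reflectAt K x) y‖ = ‖iteratedFDeriv ℝ l K (x - y)‖ := by
  have h : iteratedFDeriv ℝ l (reflectAt K x) y = (-1 : ℂ) ^ l • iteratedFDeriv ℝ l K (x - y) := by
    ext m
    rw [← SchwartzMap.iteratedLineDerivOp_eq_iteratedFDeriv, iteratedLineDerivOp_reflectAt]
    simp [reflectAt_apply, SchwartzMap.iteratedLineDerivOp_eq_iteratedFDeriv]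
  rw [h, norm_smul]
  simp

/-- Translation costs polynomial growth, because `‖y‖ ≤ (1 + ‖x‖)(1 + ‖x - y‖)`. Integration against
a Schwartz function absorbs this growth in `IsConv.smear_eq`. -/
lemma exists_seminorm_reflectAt_le (K : 𝓢(Space n, ℂ)) (k l : ℕ) :
    ∃ C : ℝ, 0 ≤ C ∧ ∀ x, SchwartzMap.seminorm ℂ k l (reflectAt K x) ≤ C * (1 + ‖x‖) ^ k := by
  refine ⟨_, ?_, fun x => SchwartzMap.seminorm_le_bound ℂ k l _ (M :=
    2 ^ k * ((Finset.Iic (k, l)).sup (fun m => SchwartzMap.seminorm ℂ m.1 m.2)) K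
      * (1 + ‖x‖) ^ k) ?_ fun y => ?_⟩
  · have := apply_nonneg ((Finset.Iic (k, l)).sup
      (fun m => SchwartzMap.seminorm (E := Space n) (F := ℂ) ℂ m.1 m.2)) K
    positivity
  · have := apply_nonneg ((Finset.Iic (k, l)).sup
      (fun m => SchwartzMap.seminorm (E := Space n) (F := ℂ) ℂ m.1 m.2)) K
    positivity
  rw [iteratedFDeriv_reflectAt_norm]
  have h1 := SchwartzMap.one_add_le_sup_seminorm_apply (𝕜 := ℂ) (m := (k, l)) le_rfl le_rfl K
    (x - y)
  have h2 : ‖y‖ ≤ (1 + ‖x‖) * (1 + ‖x - y‖) := by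
    have : ‖y‖ ≤ ‖x‖ + ‖x - y‖ := by
      calc ‖y‖ = ‖x - (x - y)‖ := by rw [sub_sub_cancel]
        _ ≤ _ := norm_sub_le _ _
    nlinarith [norm_nonneg x, norm_nonneg (x - y)]
  calc ‖y‖ ^ k * ‖iteratedFDeriv ℝ l K (x - y)‖
      ≤ ((1 + ‖x‖) * (1 + ‖x - y‖)) ^ k * ‖iteratedFDeriv ℝ l K (x - y)‖ := by gcongr
    _ = (1 + ‖x‖) ^ k * ((1 + ‖x - y‖) ^ k * ‖iteratedFDeriv ℝ l K (x - y)‖) := by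
        rw [mul_pow, mul_assoc]
    _ ≤ (1 + ‖x‖) ^ k * (2 ^ k *
          ((Finset.Iic (k, l)).sup (fun m => SchwartzMap.seminorm ℂ m.1 m.2)) K) := by gcongr
    _ = _ := by ring

/-- The mean value inequality on the unit ball around `x`, at the price of one more derivative; this
yields continuity of the translation. -/
lemma exists_seminorm_reflectAt_sub_le (K : 𝓢(Space n, ℂ)) (k l : ℕ) (x : Space n) :
    ∃ C : ℝ, ∀ x', ‖x' - x‖ ≤ 1 →
      SchwartzMap.seminorm ℂ k l (reflectAt K x' - reflectAt K x) ≤ C * ‖x' - x‖ := by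
  obtain ⟨C, hC, h⟩ := exists_seminorm_reflectAt_le K k (l + 1)
  refine ⟨C * (2 + ‖x‖) ^ k, fun x' hx' => ?_⟩
  refine SchwartzMap.seminorm_le_bound ℂ k l _ (by positivity) fun y => ?_
  have e : iteratedFDeriv ℝ l (⇑(reflectAt K x' - reflectAt K x)) y =
      (-1 : ℂ) ^ l • (iteratedFDeriv ℝ l K (x' - y) - iteratedFDeriv ℝ l K (x - y)) := by
    ext m
    rw [← SchwartzMap.iteratedLineDerivOp_eq_iteratedFDeriv, sub_eq_add_neg,
      LineDeriv.iteratedLineDerivOp_add, LineDeriv.iteratedLineDerivOp_neg,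
      iteratedLineDerivOp_reflectAt, iteratedLineDerivOp_reflectAt]
    simp [reflectAt_apply, SchwartzMap.iteratedLineDerivOp_eq_iteratedFDeriv,
      sub_eq_add_neg]
  rw [e, norm_smul, norm_pow, norm_neg, norm_one, one_pow, one_mul]
  rw [← norm_norm y, ← norm_pow, ← norm_smul, smul_sub]
  have hd : ∀ z, HasFDerivAt (fun z => ‖y‖ ^ k • iteratedFDeriv ℝ l K (z - y))
      (‖y‖ ^ k • fderiv ℝ (iteratedFDeriv ℝ l K) (z - y)) z := fun z => by
    have h1 : DifferentiableAt ℝ (iteratedFDeriv ℝ l K) (z - y) :=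
      ((K.smooth ⊤).differentiable_iteratedFDeriv (mod_cast ENat.natCast_lt_top l)) _
    have h2 : HasFDerivAt (fun z => iteratedFDeriv ℝ l K (z - y))
        (fderiv ℝ (iteratedFDeriv ℝ l K) (z - y)) z :=
      (h1.hasFDerivAt.comp z ((hasFDerivAt_id z).sub_const y)).congr_fderiv (by simp)
    exact h2.const_smul (‖y‖ ^ k)
  refine Convex.norm_image_sub_le_of_norm_hasFDerivWithin_le
    (f := fun z => ‖y‖ ^ k • iteratedFDeriv ℝ l K (z - y)) (s := Metric.closedBall x 1)
    (fun z _ => (hd z).hasFDerivWithinAt) (fun z hz => ?_) (convex_closedBall x 1)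
    (by simp) (by simpa [dist_eq_norm] using hx')
  rw [norm_smul, norm_pow, norm_norm, norm_fderiv_iteratedFDeriv, ← iteratedFDeriv_reflectAt_norm]
  refine (SchwartzMap.le_seminorm ℂ k (l + 1) _ y).trans ((h z).trans ?_)
  have : ‖z‖ ≤ 1 + ‖x‖ := by
    have h1 : ‖z - x‖ ≤ 1 := by simpa [dist_eq_norm] using hz
    have h2 := norm_sub_norm_le z x
    linarith
  have h3 : 1 + ‖z‖ ≤ 2 + ‖x‖ := by linarith
  gcongr

lemma continuous_reflectAt (K : 𝓢(Space n, ℂ)) : Continuous (reflectAt K) := by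
  rw [continuous_iff_continuousAt]
  intro x
  refine ((schwartz_withSeminorms ℂ (Space n) ℂ).tendsto_nhds _ _).2 fun i ε hε => ?_
  obtain ⟨C, h⟩ := exists_seminorm_reflectAt_sub_le K i.1 i.2 x
  have h1 : Filter.Tendsto (fun x' => C * ‖x' - x‖) (nhds x) (nhds 0) := by
    have : Continuous fun x' : Space n => C * ‖x' - x‖ := by fun_prop
    simpa using this.tendsto x
  filter_upwards [h1.eventually (gt_mem_nhds hε), Metric.closedBall_mem_nhds x one_pos]
    with x' h2 h3
  exact (h x' (by simpa [dist_eq_norm] using h3)).trans_lt h2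

lemma fourier_lineDerivOp_apply (K : 𝓢(Space n, ℂ)) (v ξ : Space n) :
    𝓕 (∂_{v} K) ξ = (2 * Real.pi * Complex.I) * (inner ℝ ξ v : ℝ) * 𝓕 K ξ := by
  have : (inner ℝ · v : Space n → ℝ).HasTemperateGrowth := by fun_prop
  rw [SchwartzMap.fourier_lineDerivOp_eq, smul_apply,
    SchwartzMap.smulLeftCLM_apply_apply this]
  simp [mul_assoc]

lemma eq_of_fourier_eq {A B : 𝓢(Space n, ℂ)} (h : ∀ ξ, 𝓕 A ξ = 𝓕 B ξ) : A = B := by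
  have e : 𝓕 A = 𝓕 B := SchwartzMap.ext h
  have hA : 𝓕⁻ (𝓕 A) = A := FourierTransform.fourierInv_fourier_eq A
  have hB : 𝓕⁻ (𝓕 B) = B := FourierTransform.fourierInv_fourier_eq B
  rw [← hA, e, hB]

lemma lineDerivOp_comm (K : 𝓢(Space n, ℂ)) (v w : Space n) :
    ∂_{v} (∂_{w} K) = ∂_{w} (∂_{v} K) := by
  refine eq_of_fourier_eq fun ξ => ?_
  simp_rw [fourier_lineDerivOp_apply]
  ring

lemma lineDerivOp_iterated_comm (K : 𝓢(Space n, ℂ)) (v : Space n) {l : ℕ} (m : Fin l → Space n) :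
    ∂^{m} (∂_{v} K) = ∂_{v} (∂^{m} K) := by
  induction l with
  | zero => rfl
  | succ l ih =>
    rw [LineDeriv.iteratedLineDerivOp_succ_left, ih, lineDerivOp_comm,
      LineDeriv.iteratedLineDerivOp_succ_left]

end Reflect

/-! ### Convolution of a tempered distribution with a Schwartz function -/

section Smear

variable {n : ℕ} {F : Type*} [NormedAddCommGroup F] [NormedSpace ℂ F]

/-- The convolution of a tempered distribution with a Schwartz function, as a function. -/
def smear (u : 𝓢(Space n, ℂ) →L[ℂ] F) (K : 𝓢(Space n, ℂ)) (x : Space n) : F :=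
  u (reflectAt K x)

lemma continuous_smear (u : 𝓢(Space n, ℂ) →L[ℂ] F) (K : 𝓢(Space n, ℂ)) :
    Continuous (smear u K) :=
  u.continuous.comp (continuous_reflectAt K)

/-- The fundamental theorem of calculus for `K`, with `u` moved inside the integral. It avoids
convergence of difference quotients in Schwartz space. -/
lemma smear_add_sub [CompleteSpace F] (u : 𝓢(Space n, ℂ) →L[ℂ] F) (K : 𝓢(Space n, ℂ))
    (x h : Space n) :
    smear u K (x + h) - smear u K x = ∫ t in (0 : ℝ)..1, smear u (∂_{h} K) (x + t • h) := by
  have hc : Continuous fun t : ℝ => reflectAt (∂_{h} K) (x + t • h) :=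
    (continuous_reflectAt _).comp (by fun_prop)
  rw [intervalIntegral.integral_of_le zero_le_one]
  unfold smear
  rw [← map_sub]
  refine apply_eq_integral u hc (fun k l => ?_) _ fun l m y => ?_
  · exact (((schwartz_withSeminorms ℂ (Space n) ℂ).continuous_seminorm (k, l)).comp
      hc).integrableOn_Ioc
  · rw [sub_eq_add_neg, LineDeriv.iteratedLineDerivOp_add, LineDeriv.iteratedLineDerivOp_neg,
      iteratedLineDerivOp_reflectAt, iteratedLineDerivOp_reflectAt]
    simp_rw [iteratedLineDerivOp_reflectAt, lineDerivOp_iterated_comm]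
    simp only [smul_apply, add_apply, neg_apply, reflectAt_apply]
    rw [integral_smul, ← intervalIntegral.integral_of_le zero_le_one,
      ← smul_neg, ← smul_add, ← sub_eq_add_neg]
    congr 1
    have hd : ∀ t : ℝ, HasDerivAt (fun t : ℝ => (∂^{m} K) (x + t • h - y))
        ((∂_{h} (∂^{m} K)) (x + t • h - y)) t := fun t => by
      have h1 : HasDerivAt (fun t : ℝ => x + t • h - y) h t := by
        simpa using (((hasDerivAt_id t).smul_const h).const_add x).sub_const y
      rw [SchwartzMap.lineDerivOp_apply_eq_fderiv]
      exact ((∂^{m} K).hasFDerivAt (x + t • h - y)).comp_hasDerivAt t h1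
    rw [intervalIntegral.integral_eq_sub_of_hasDerivAt (fun t _ => hd t)]
    · simp
    · exact ((∂_{h} (∂^{m} K)).continuous.comp (by fun_prop)).intervalIntegrable _ _

/-- The derivative of `smear u K`. -/
def smearDeriv (u : 𝓢(Space n, ℂ) →L[ℂ] F) (K : 𝓢(Space n, ℂ)) (x : Space n) : Space n →L[ℝ] F :=
  ∑ i, (EuclideanSpace.proj i : Space n →L[ℝ] ℝ).smulRight
    (smear u (∂_{EuclideanSpace.single i (1 : ℝ)} K) x)

lemma smearDeriv_apply (u : 𝓢(Space n, ℂ) →L[ℂ] F) (K : 𝓢(Space n, ℂ)) (x h : Space n) :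
    smearDeriv u K x h = smear u (∂_{h} K) x := by
  have e : h = ∑ i, h i • EuclideanSpace.single i (1 : ℝ) := by
    ext j
    simp [Finset.sum_apply, Pi.single_apply]
  have e2 : ∂_{h} K = ∑ i, ((h i : ℝ) : ℂ) • ∂_{EuclideanSpace.single i (1 : ℝ)} K := by
    conv_lhs => rw [e]
    rw [LineDeriv.lineDerivOp_left_sum]
    refine Finset.sum_congr rfl fun i _ => ?_
    rw [LineDeriv.lineDerivOp_left_smul]
    ext y
    simp
  have e3 : ∀ (s : Finset (Fin n)) (f : Fin n → 𝓢(Space n, ℂ)),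
      reflectAt (∑ i ∈ s, f i) x = ∑ i ∈ s, reflectAt (f i) x := fun s f => by
    simp [reflectAt]
  rw [smear, e2, e3, map_sum, smearDeriv, sum_apply]
  refine Finset.sum_congr rfl fun i _ => ?_
  rw [reflectAt_smul, map_smul]
  simp [smear]

/-- The remainder is the integral over the segment of an increment of `smearDeriv`, which is small
because `smearDeriv` is continuous. -/
lemma hasFDerivAt_smear [CompleteSpace F] (u : 𝓢(Space n, ℂ) →L[ℂ] F) (K : 𝓢(Space n, ℂ))
    (x : Space n) : HasFDerivAt (smear u K) (smearDeriv u K x) x := by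
  have hcont : Continuous (smearDeriv u K) :=
    continuous_finsetSum _ fun i _ =>
      (ContinuousLinearMap.smulRightL ℝ (Space n) F (EuclideanSpace.proj i)).continuous.comp
        (continuous_smear u _)
  rw [hasFDerivAt_iff_isLittleO_nhds_zero, Asymptotics.isLittleO_iff]
  intro c hc
  obtain ⟨δ, hδ, hball⟩ := Metric.continuousAt_iff.1 (hcont.continuousAt (x := x)) c hc
  filter_upwards [Metric.ball_mem_nhds 0 hδ] with h hh
  have hh' : ‖h‖ < δ := by simpa using hh
  have hi : IntervalIntegrable (fun t : ℝ => smearDeriv u K (x + t • h) h) volume 0 1 :=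
    ((hcont.comp (by fun_prop)).clm_apply continuous_const).intervalIntegrable _ _
  have e : smear u K (x + h) - smear u K x - smearDeriv u K x h =
      ∫ t in (0 : ℝ)..1, (smearDeriv u K (x + t • h) - smearDeriv u K x) h := by
    simp_rw [sub_apply]
    rw [intervalIntegral.integral_sub hi (by simp), smear_add_sub]
    simp [smearDeriv_apply]
  rw [e]
  refine (intervalIntegral.norm_integral_le_of_norm_le_const (C := c * ‖h‖)
    fun t ht => ?_).trans_eq (by simp)
  rw [Set.uIoc_of_le zero_le_one] at ht
  refine ((ContinuousLinearMap.le_opNorm _ h)).trans ?_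
  gcongr
  rw [← dist_eq_norm]
  refine (hball ?_).le
  rw [dist_eq_norm, add_sub_cancel_left, norm_smul, Real.norm_of_nonneg ht.1.le]
  exact (mul_le_of_le_one_left (norm_nonneg h) ht.2).trans_lt hh'

lemma contDiff_smear [CompleteSpace F] (u : 𝓢(Space n, ℂ) →L[ℂ] F) (K : 𝓢(Space n, ℂ)) :
    ContDiff ℝ ∞ (smear u K) := by
  refine contDiff_infty.2 fun k => ?_
  induction k generalizing K with
  | zero => exact contDiff_zero.2 (continuous_smear u K)
  | succ k ih =>
    refine contDiff_succ_iff_hasFDerivAt.2 ⟨smearDeriv u K, ?_, hasFDerivAt_smear u K⟩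
    exact ContDiff.sum fun i _ =>
      (ContinuousLinearMap.smulRightL ℝ (Space n) F (EuclideanSpace.proj i)).contDiff.comp (ih _)

/-- `D = A * B`, expressed on the Fourier side. -/
def IsConv (A B D : 𝓢(Space n, ℂ)) : Prop :=
  ∀ ξ, 𝓕 D ξ = 𝓕 A ξ * 𝓕 B ξ

namespace IsConv

variable {A B D : 𝓢(Space n, ℂ)}

lemma lineDerivOp_right (h : IsConv A B D) (v : Space n) : IsConv A (∂_{v} B) (∂_{v} D) := by
  intro ξ
  rw [fourier_lineDerivOp_apply, fourier_lineDerivOp_apply, h ξ]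
  ring

lemma symm (h : IsConv A B D) : IsConv B A D := fun ξ => by rw [h ξ, mul_comm]

lemma iteratedLineDerivOp_right (h : IsConv A B D) {l : ℕ} (m : Fin l → Space n) :
    IsConv A (∂^{m} B) (∂^{m} D) := by
  induction l with
  | zero => exact h
  | succ l ih => exact (ih _).lineDerivOp_right _

lemma apply_eq (h : IsConv A B D) (x : Space n) : D x = ∫ z, A z * B (x - z) := by
  have e : D = SchwartzMap.convolution (ContinuousLinearMap.mul ℂ ℂ) A B := by
    refine eq_of_fourier_eq fun ξ => ?_
    rw [SchwartzMap.fourier_convolution, h ξ]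
    simp
  rw [e, SchwartzMap.convolution_apply]
  rfl

/-- Associativity `u * (A * B) = A * (u * B)`: the Schwartz function `D` is the integral of the
translates of `B` weighted by `A`, and the decay of `A` beats the growth of their seminorms. -/
lemma smear_eq [CompleteSpace F] (h : IsConv A B D) (u : 𝓢(Space n, ℂ) →L[ℂ] F) (x : Space n) :
    smear u D x = ∫ z, A z • smear u B (x - z) := by
  unfold smear
  simp_rw [← map_smul]
  refine apply_eq_integral u ?_ (fun k l => ?_) _ fun l m y => ?_
  · exact A.continuous.smul ((continuous_reflectAt B).comp (by fun_prop))
  · obtain ⟨C, hC, hB⟩ := exists_seminorm_reflectAt_le B k l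
    have hc : Continuous fun z => SchwartzMap.seminorm ℂ k l (A z • reflectAt B (x - z)) :=
      ((schwartz_withSeminorms ℂ (Space n) ℂ).continuous_seminorm (k, l)).comp
        (A.continuous.smul ((continuous_reflectAt B).comp (by fun_prop)))
    have hg : Integrable fun z => C * (1 + ‖x‖) ^ k * 2 ^ k * (‖A z‖ + ‖z‖ ^ k * ‖A z‖) :=
      (A.integrable.norm.add (A.integrable_pow_mul volume k)).const_mul _
    refine hg.mono' hc.aestronglyMeasurable (.of_forall fun z => ?_)
    rw [Real.norm_of_nonneg (apply_nonneg _ _), map_smul_eq_mul]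
    have h1 : 1 + ‖x - z‖ ≤ (1 + ‖x‖) * (1 + ‖z‖) := by
      have := norm_sub_le x z
      nlinarith [norm_nonneg x, norm_nonneg z]
    have h2 : (1 + ‖z‖) ^ k ≤ 2 ^ k * (1 + ‖z‖ ^ k) := by
      refine (add_pow_le zero_le_one (norm_nonneg z) k).trans ?_
      rw [one_pow]
      gcongr
      · norm_num
      · omega
    calc ‖A z‖ * SchwartzMap.seminorm ℂ k l (reflectAt B (x - z))
        ≤ ‖A z‖ * (C * (1 + ‖x - z‖) ^ k) := by gcongr; exact hB _
      _ ≤ ‖A z‖ * (C * ((1 + ‖x‖) * (1 + ‖z‖)) ^ k) := by gcongr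
      _ ≤ ‖A z‖ * (C * ((1 + ‖x‖) ^ k * (2 ^ k * (1 + ‖z‖ ^ k)))) := by rw [mul_pow]; gcongr
      _ = _ := by ring
  · rw [iteratedLineDerivOp_reflectAt]
    simp_rw [LineDeriv.iteratedLineDerivOp_smul, iteratedLineDerivOp_reflectAt]
    simp only [smul_apply, reflectAt_apply]
    simp_rw [smul_comm _ ((-1 : ℂ) ^ l)]
    rw [integral_smul, (h.iteratedLineDerivOp_right m).apply_eq]
    simp [sub_right_comm]

end IsConv

end Smear

end DerivNLS
end

noncomputable section

namespace DerivNLS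

/-! ### Averages over thin tubes -/

section Averages

variable {n : ℕ}

/-- Averages along translates of a curve are preserved by averaging over translations. -/
lemma lintegral_conv_le {ν : Measure ℝ} [SFinite ν] {γ : ℝ → Space n} (hγ : Measurable γ)
    {f k : Space n → ℝ≥0∞} (hf : Measurable f) (hk : Measurable k) {τ : Space n → Space n}
    (hτ : Measurable τ) {S : ℝ≥0∞} (h : ∀ y, ∫⁻ t, f (y + γ t) ∂ν ≤ S) (y : Space n) :
    ∫⁻ t, (∫⁻ z, k z * f (y + γ t - τ z)) ∂ν ≤ (∫⁻ z, k z) * S := by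
  rw [lintegral_lintegral_swap (by fun_prop), ← lintegral_mul_const _ hk]
  refine lintegral_mono fun z => ?_
  rw [lintegral_const_mul _ (by fun_prop)]
  gcongr
  simpa only [add_sub_right_comm] using h (y - τ z)

/-- The Cauchy-Schwarz inequality for a constant and a function. -/
lemma lintegral_le_sqrt_mul {T : Type*} [MeasurableSpace T] {ν : Measure T} {f : T → ℝ≥0∞}
    (hf : AEMeasurable f ν) :
    ∫⁻ t, f t ∂ν ≤ (∫⁻ t, f t ^ 2 ∂ν) ^ (1 / 2 : ℝ) * ν Set.univ ^ (1 / 2 : ℝ) := by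
  have h := ENNReal.lintegral_mul_le_Lp_mul_Lq ν Real.HolderConjugate.two_two hf
    (g := fun _ => 1) aemeasurable_const
  simpa using h

lemma lintegral_ball_eq {f : Space n → ℝ≥0∞} (x c : Space n) (ρ : ℝ) :
    ∫⁻ z in Metric.ball c ρ, f (x - z) = ∫⁻ w in Metric.ball (x - c) ρ, f w := by
  rw [← lintegral_indicator measurableSet_ball, ← lintegral_indicator measurableSet_ball,
    ← lintegral_sub_left_eq_self _ x]
  refine lintegral_congr fun z => ?_
  have h0 : x - z ∈ Metric.ball c ρ ↔ z ∈ Metric.ball (x - c) ρ := by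
    rw [Metric.mem_ball, Metric.mem_ball, dist_eq_norm, dist_eq_norm, ← norm_neg]
    congr! 2
    abel
  by_cases h : z ∈ Metric.ball (x - c) ρ
  · simp only [Set.indicator_of_mem h, Set.indicator_of_mem (h0.2 h), sub_sub_cancel]
  · simp only [Set.indicator_of_notMem h, Set.indicator_of_notMem (mt h0.1 h)]

/-- Projecting `w - y` onto the line confines `r` to an interval of radius `ρ`. -/
lemma volume_line_inter_ball_le {θ : Space n} (hθ : ‖θ‖ = 1) (y w : Space n) (ρ : ℝ) :
    volume {r : ℝ | w ∈ Metric.ball (y + r • θ) ρ} ≤ ENNReal.ofReal (2 * ρ) := by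
  rw [← Real.volume_ball (inner ℝ θ (w - y)) ρ]
  refine measure_mono fun r hr => ?_
  have e : inner ℝ θ (w - (y + r • θ)) = inner ℝ θ (w - y) - r := by
    rw [← sub_sub, inner_sub_right, inner_smul_right, real_inner_self_eq_norm_sq, hθ]
    ring
  have h1 : ‖w - (y + r • θ)‖ < ρ := by simpa [dist_eq_norm] using hr
  have h2 := abs_real_inner_le_norm θ (w - (y + r • θ))
  rw [e, hθ, one_mul] at h2
  rw [Metric.mem_ball, Real.dist_eq, abs_sub_comm]
  exact h2.trans_lt h1

/-- Averages over small balls centred on a segment are controlled by the `L²` norm on the ball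
which contains them. -/
lemma lintegral_segment_ball_le {f : Space n → ℝ≥0∞} (hf : Measurable f) {θ : Space n}
    (hθ : ‖θ‖ = 1) (y c : Space n) {I : Set ℝ} (hI : MeasurableSet I) {ρ R : ℝ}
    (hsub : ∀ r ∈ I, Metric.ball (y + r • θ) ρ ⊆ Metric.ball c R) :
    ∫⁻ r in I, ∫⁻ z in Metric.ball 0 ρ, f (y + r • θ - z) ≤
      (ENNReal.ofReal (2 * ρ) * ∫⁻ w in Metric.ball c R, f w ^ 2) ^ (1 / 2 : ℝ) *
        (volume I * volume (Metric.ball (0 : Space n) ρ)) ^ (1 / 2 : ℝ) := by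
  have hm : Measurable fun p : ℝ × Space n => f (y + p.1 • θ - p.2) := by fun_prop
  have h1 := lintegral_le_sqrt_mul
    (ν := (volume.restrict I).prod (volume.restrict (Metric.ball (0 : Space n) ρ)))
    (f := fun p : ℝ × Space n => f (y + p.1 • θ - p.2)) hm.aemeasurable
  rw [lintegral_prod _ hm.aemeasurable,
    lintegral_prod _ (hm.pow_const 2).aemeasurable, ← Set.univ_prod_univ, Measure.prod_prod,
    Measure.restrict_apply_univ, Measure.restrict_apply_univ] at h1
  refine h1.trans ?_
  gcongr
  simp_rw [lintegral_ball_eq (f := fun w => f w ^ 2), sub_zero]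
  have h2 : ∀ r ∈ I, ∫⁻ w in Metric.ball (y + r • θ) ρ, f w ^ 2 =
      ∫⁻ w in Metric.ball c R, (Metric.ball (y + r • θ) ρ).indicator (fun w => f w ^ 2) w := by
    intro r hr
    rw [lintegral_indicator measurableSet_ball, Measure.restrict_restrict measurableSet_ball,
      Set.inter_eq_left.2 (hsub r hr)]
  rw [setLIntegral_congr_fun hI h2]
  have hset : MeasurableSet {p : ℝ × Space n | p.2 ∈ Metric.ball (y + p.1 • θ) ρ} := by
    have : IsOpen {p : ℝ × Space n | dist p.2 (y + p.1 • θ) < ρ} :=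
      isOpen_lt (by fun_prop) (by fun_prop)
    exact this.measurableSet
  have hm2 : Measurable fun p : ℝ × Space n =>
      (Metric.ball (y + p.1 • θ) ρ).indicator (fun w => f w ^ 2) p.2 :=
    Measurable.indicator (f := fun p : ℝ × Space n => f p.2 ^ 2) (by fun_prop) hset
  -- After Fubini each `w` is counted with the length of the set of parameters `r` whose ball
  -- contains it, at most `2ρ`.
  rw [lintegral_lintegral_swap hm2.aemeasurable, mul_comm,
    ← lintegral_mul_const _ (by fun_prop)]
  refine lintegral_mono fun w => ?_
  have h3 : ∀ r, (Metric.ball (y + r • θ) ρ).indicator (fun w => f w ^ 2) w =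
      {r : ℝ | w ∈ Metric.ball (y + r • θ) ρ}.indicator (fun _ => f w ^ 2) r := fun r => by
    simp [Set.indicator]
  simp_rw [h3]
  have hs : MeasurableSet {r : ℝ | w ∈ Metric.ball (y + r • θ) ρ} :=
    (measurable_prodMk_right (y := w)) hset
  rw [lintegral_indicator_const hs]
  gcongr
  exact (Measure.restrict_apply_le I _).trans (volume_line_inter_ball_le hθ y w ρ)

end Averages

/-! ### Bernstein-type estimates along half-lines in `𝒟L²` -/

section Balls

variable {n m : ℕ}

/-- The `L²` norms which enter `dlNorm`. -/
def ballNorm (l : ℝ) (v : Space n → Val m) (x₀ θ : Space n) (k : ℕ) : ℝ≥0∞ :=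
  eLpNorm ({x : Space n | ‖l⁻¹ • (x - x₀) - (k : ℝ) • θ‖ < 1}.indicator v) 2 volume

lemma ballNorm_eq {l : ℝ} (hl : 0 < l) (v : Space n → Val m) (x₀ θ : Space n) (k : ℕ) :
    ballNorm l v x₀ θ k =
      (∫⁻ w in Metric.ball (x₀ + (k * l) • θ) l, ‖v w‖ₑ ^ 2) ^ (1 / 2 : ℝ) := by
  have hs : {x : Space n | ‖l⁻¹ • (x - x₀) - (k : ℝ) • θ‖ < 1} =
      Metric.ball (x₀ + (k * l) • θ) l := by
    ext x
    rw [Metric.mem_ball, dist_eq_norm, Set.mem_ofPred_eq]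
    have : x - (x₀ + (k * l) • θ) = l • (l⁻¹ • (x - x₀) - (k : ℝ) • θ) := by
      rw [smul_sub, smul_smul, smul_smul, mul_inv_cancel₀ hl.ne', one_smul, mul_comm l, sub_sub]
    rw [this, norm_smul, Real.norm_of_nonneg hl.le, mul_lt_iff_lt_one_right hl]
  rw [ballNorm, hs, eLpNorm_indicator_eq_eLpNorm_restrict measurableSet_ball,
    eLpNorm_eq_lintegral_rpow_enorm_toReal (by norm_num) (by norm_num)]
  simp

lemma tsum_ballNorm_le (l : ℝ) (v : Space n → Val m) (x₀ : Space n) {θ : Space n}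
    (hθ : ‖θ‖ = 1) : ∑' k, ballNorm l v x₀ θ k ≤ dlNorm l v :=
  le_iSup₂_of_le x₀ θ (le_iSup_of_le hθ le_rfl)

lemma volume_ball_zero (ρ : ℝ) (hρ : 0 < ρ) :
    volume (Metric.ball (0 : Space n) ρ) =
      ENNReal.ofReal (ρ ^ n) * volume (Metric.ball (0 : Space n) 1) := by
  rw [Measure.addHaar_ball_of_pos _ _ hρ]
  simp

/-- The average of `v` over balls of radius `1 / (2 l)`, up to a factor. -/
def ballAverage (l : ℝ) (v : Space n → Val m) (y : Space n) : ℝ≥0∞ :=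
  ENNReal.ofReal ((2 * l) ^ n) * ∫⁻ z in Metric.ball 0 (2 * l)⁻¹, ‖v (y - z)‖ₑ

lemma measurable_ballAverage (l : ℝ) {v : Space n → Val m} (hv : Measurable v) :
    Measurable (ballAverage l v) := by
  have : Measurable fun p : Space n × Space n => ‖v (p.1 - p.2)‖ₑ := by fun_prop
  exact this.lintegral_prod_right'.const_mul _

/-- The constant in the estimate of ball averages. -/
def ballConst (n : ℕ) (l : ℝ) : ℝ≥0∞ :=
  (ENNReal.ofReal ((2 * l) ^ n) * volume (Metric.ball (0 : Space n) 1)) ^ (1 / 2 : ℝ)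

lemma mul_sqrt_eq_ballConst {l : ℝ} (hl : 0 < l) :
    ENNReal.ofReal ((2 * l) ^ n) *
      (volume (Metric.ball (0 : Space n) (2 * l)⁻¹)) ^ (1 / 2 : ℝ) = ballConst n l := by
  have hp : 0 < (2 * l) ^ n := by positivity
  rw [volume_ball_zero _ (by positivity), ballConst, ENNReal.mul_rpow_of_nonneg _ _ (by norm_num),
    ENNReal.mul_rpow_of_nonneg _ _ (by norm_num), ← mul_assoc]
  congr 1
  rw [ENNReal.ofReal_rpow_of_pos (by positivity), ENNReal.ofReal_rpow_of_pos hp,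
    ← ENNReal.ofReal_mul hp.le]
  congr 1
  rw [inv_pow, Real.inv_rpow hp.le, ← Real.sqrt_eq_rpow]
  nth_rw 1 [← Real.mul_self_sqrt hp.le]
  have := (Real.sqrt_pos.2 hp).ne'
  field_simp

/-- Cauchy-Schwarz on one small ball, which lies in the `k = 0` ball of `dlNorm`. The direction `θ`
only serves to make the supremum nonempty. -/
lemma ballAverage_le {l : ℝ} (hl : 1 ≤ l) {v : Space n → Val m} (hv : Measurable v) {θ : Space n}
    (hθ : ‖θ‖ = 1) (y : Space n) : ballAverage l v y ≤ ballConst n l * dlNorm l v := by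
  have hl0 : 0 < l := by linarith
  have h1 := lintegral_le_sqrt_mul (ν := volume.restrict (Metric.ball (0 : Space n) (2 * l)⁻¹))
    (f := fun z => ‖v (y - z)‖ₑ) (by fun_prop)
  rw [lintegral_ball_eq (f := fun w => ‖v w‖ₑ ^ 2), sub_zero, Measure.restrict_apply_univ] at h1
  have h2 : (∫⁻ w in Metric.ball y (2 * l)⁻¹, ‖v w‖ₑ ^ 2) ^ (1 / 2 : ℝ) ≤ dlNorm l v := by
    refine le_trans ?_ ((ENNReal.le_tsum 0).trans (tsum_ballNorm_le l v y hθ))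
    rw [ballNorm_eq hl0]
    have h3 : (2 * l)⁻¹ ≤ l := by
      rw [inv_le_iff_one_le_mul₀ (by positivity)]
      nlinarith
    simp only [Nat.cast_zero, zero_mul, zero_smul, add_zero]
    gcongr
  calc ballAverage l v y
      ≤ ENNReal.ofReal ((2 * l) ^ n) * (dlNorm l v *
        (volume (Metric.ball (0 : Space n) (2 * l)⁻¹)) ^ (1 / 2 : ℝ)) := by
        unfold ballAverage
        gcongr
        exact h1.trans (by gcongr)
    _ = _ := by rw [← mul_sqrt_eq_ballConst hl0]; ring

/-- The half-line is cut into segments of length `l`. The averaging balls met by the `k`-th segment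
lie in the `k`-th ball of `dlNorm` based at `y + (l/2)θ`, because `l/2 + 1/(2l) ≤ l` for `l ≥ 1`. -/
lemma lintegral_ballAverage_le {l : ℝ} (hl : 1 ≤ l) {v : Space n → Val m} (hv : Measurable v)
    {θ : Space n} (hθ : ‖θ‖ = 1) (y : Space n) :
    ∫⁻ r in Set.Ioi (0 : ℝ), ballAverage l v (y + r • θ) ≤ ballConst n l * dlNorm l v := by
  have hl0 : 0 < l := by linarith
  have hcover : Set.Ioi (0 : ℝ) ⊆ ⋃ k : ℕ, Set.Ioc (k * l) ((k + 1) * l) := by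
    intro r hr
    have h1 : 0 < r / l := div_pos hr hl0
    have h2 : 0 < ⌈r / l⌉₊ := Nat.ceil_pos.2 h1
    have h3 : ((⌈r / l⌉₊ - 1 : ℕ) : ℝ) = ⌈r / l⌉₊ - 1 := by
      rw [Nat.cast_sub h2]; simp
    refine Set.mem_iUnion.2 ⟨⌈r / l⌉₊ - 1, ?_, ?_⟩
    · rw [h3, ← lt_div_iff₀ hl0]
      have := Nat.ceil_lt_add_one h1.le
      linarith
    · rw [h3, ← div_le_iff₀ hl0]
      simpa using Nat.le_ceil (r / l)
  have hk : ∀ k : ℕ, ∫⁻ r in Set.Ioc (k * l) ((k + 1) * l), ballAverage l v (y + r • θ) ≤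
      ballConst n l * ballNorm l v (y + (l / 2) • θ) θ k := by
    intro k
    have hsub : ∀ r ∈ Set.Ioc (k * l) ((k + 1) * l), Metric.ball (y + r • θ) (2 * l)⁻¹ ⊆
        Metric.ball (y + (l / 2) • θ + (k * l) • θ) l := by
      intro r hr
      refine Metric.ball_subset_ball' ?_
      have e : y + r • θ - (y + (l / 2) • θ + (k * l) • θ) = (r - l / 2 - k * l) • θ := by
        module
      rw [dist_eq_norm, e, norm_smul, hθ, mul_one, Real.norm_eq_abs]
      have h1 : |r - l / 2 - k * l| ≤ l / 2 := by
        rw [abs_le]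
        constructor <;> nlinarith [hr.1, hr.2]
      have h3 : (2 * l)⁻¹ ≤ l / 2 := by
        rw [inv_le_iff_one_le_mul₀ (by positivity)]
        nlinarith
      linarith
    have h1 := lintegral_segment_ball_le (f := fun w => ‖v w‖ₑ) (by fun_prop) hθ y _
      measurableSet_Ioc hsub
    have hmeas : Measurable fun r : ℝ =>
        ∫⁻ z in Metric.ball 0 (2 * l)⁻¹, ‖v (y + r • θ - z)‖ₑ := by
      have : Measurable fun p : ℝ × Space n => ‖v (y + p.1 • θ - p.2)‖ₑ := by fun_prop
      exact this.lintegral_prod_right'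
    unfold ballAverage
    rw [lintegral_const_mul _ hmeas, ballNorm_eq hl0, ← mul_sqrt_eq_ballConst hl0]
    refine (mul_le_mul_right h1 _).trans_eq ?_
    have hv1 : volume (Set.Ioc (k * l) ((k + 1) * l)) = ENNReal.ofReal l := by
      rw [Real.volume_Ioc]; congr 1; ring
    rw [hv1, ENNReal.mul_rpow_of_nonneg _ _ (by norm_num),
      ENNReal.mul_rpow_of_nonneg _ _ (by norm_num)]
    -- The tube width `1/l` gained by Fubini cancels the segment length `l` lost by Cauchy-Schwarz,
    -- so the constant equals the pointwise one.
    have h4 : ENNReal.ofReal (2 * (2 * l)⁻¹) ^ (1 / 2 : ℝ) * ENNReal.ofReal l ^ (1 / 2 : ℝ) = 1 := by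
      rw [← ENNReal.mul_rpow_of_nonneg _ _ (by norm_num), ← ENNReal.ofReal_mul (by positivity)]
      have : 2 * (2 * l)⁻¹ * l = 1 := by field_simp
      rw [this, ENNReal.ofReal_one, ENNReal.one_rpow]
    have h5 : ∀ a p q r t : ℝ≥0∞, p * r = 1 → a * (p * q * (r * t)) = a * t * q := by
      intro a p q r t hpr
      calc a * (p * q * (r * t)) = (p * r) * (a * t * q) := by ring
        _ = _ := by rw [hpr, one_mul]
    exact h5 _ _ _ _ _ h4
  calc ∫⁻ r in Set.Ioi (0 : ℝ), ballAverage l v (y + r • θ)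
      ≤ ∫⁻ r in ⋃ k : ℕ, Set.Ioc (k * l) ((k + 1) * l), ballAverage l v (y + r • θ) :=
        lintegral_mono_set hcover
    _ ≤ ∑' k : ℕ, ∫⁻ r in Set.Ioc (k * l) ((k + 1) * l), ballAverage l v (y + r • θ) :=
        lintegral_iUnion_le _ _
    _ ≤ ∑' k, ballConst n l * ballNorm l v (y + (l / 2) • θ) θ k := ENNReal.tsum_le_tsum hk
    _ = ballConst n l * ∑' k, ballNorm l v (y + (l / 2) • θ) θ k := ENNReal.tsum_mul_left
    _ ≤ _ := by gcongr; exact tsum_ballNorm_le l v _ hθ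

/-- Curves along which the translates of ball averages are controlled by `dlNorm`. -/
structure Admissible (ν : Measure ℝ) (γ : ℝ → Space n) : Prop where
  sfinite : SFinite ν
  measurable : Measurable γ
  le : ∀ (m : ℕ) (l : ℝ) (v : Space n → Val m), 1 ≤ l → Measurable v → ∀ y,
    ∫⁻ t, ballAverage l v (y + γ t) ∂ν ≤ ballConst n l * dlNorm l v

/-- A Dirac mass turns integrals along curves into point values, so pointwise bounds follow from the
same argument as bounds on rays. -/
lemma admissible_dirac {θ : Space n} (hθ : ‖θ‖ = 1) :
    Admissible (Measure.dirac 0) (fun _ => (0 : Space n)) where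
  sfinite := inferInstance
  measurable := measurable_const
  le m l v hl hv y := by simpa using ballAverage_le hl hv hθ y

lemma admissible_halfLine {θ : Space n} (hθ : ‖θ‖ = 1) :
    Admissible (volume.restrict (Set.Ioi 0)) (fun r => r • θ) where
  sfinite := inferInstance
  measurable := by fun_prop
  le m l v hl hv y := lintegral_ballAverage_le hl hv hθ y

/-- The convolution of `|v|` with the dilate `(2 l)ⁿ |Φ(2 l ·)|`. -/
def kernelAverage (l : ℝ) (Φ : 𝓢(Space n, ℂ)) (v : Space n → Val m) (y : Space n) : ℝ≥0∞ :=
  ∫⁻ z, ENNReal.ofReal ((2 * l) ^ n) * ‖Φ ((2 * l) • z)‖ₑ * ‖v (y - z)‖ₑ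

lemma measurable_kernelAverage (l : ℝ) (Φ : 𝓢(Space n, ℂ)) {v : Space n → Val m}
    (hv : Measurable v) : Measurable (kernelAverage l Φ v) := by
  have hΦ : Measurable Φ := Φ.continuous.measurable
  have : Measurable fun p : Space n × Space n =>
      ENNReal.ofReal ((2 * l) ^ n) * ‖Φ ((2 * l) • p.2)‖ₑ * ‖v (p.1 - p.2)‖ₑ := by fun_prop
  exact this.lintegral_prod_right'

/-- Decay of order `n + 1` is integrable and changes by at most a constant factor over a unit ball.
-/
lemma exists_integrable_local_bound (Φ : 𝓢(Space n, ℂ)) :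
    ∃ φ : Space n → ℝ≥0∞, Measurable φ ∧ ∫⁻ p, φ p ≠ ⊤ ∧
      ∀ x p, x ∈ Metric.ball p 1 → ‖Φ x‖ₑ ≤ φ p := by
  set C₀ : ℝ := 2 ^ (n + 1) *
    ((Finset.Iic (n + 1, 0)).sup (fun m => SchwartzMap.seminorm ℂ m.1 m.2)) Φ with hC₀
  have hdecay : ∀ x, (1 + ‖x‖) ^ (n + 1) * ‖Φ x‖ ≤ C₀ := fun x => by
    simpa using SchwartzMap.one_add_le_sup_seminorm_apply (𝕜 := ℂ) (m := (n + 1, 0)) le_rfl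
      le_rfl Φ x
  have hint : Integrable fun p : Space n => C₀ * 2 ^ (n + 1) * (1 + ‖p‖) ^ (-((n : ℝ) + 1)) :=
    (integrable_one_add_norm (by simp)).const_mul _
  refine ⟨fun p => ENNReal.ofReal (C₀ * 2 ^ (n + 1) * (1 + ‖p‖) ^ (-((n : ℝ) + 1))),
    by fun_prop, hint.lintegral_lt_top.ne, fun x p hx => ?_⟩
  rw [← ofReal_norm]
  refine ENNReal.ofReal_le_ofReal ?_
  have h1 : 1 + ‖p‖ ≤ 2 * (1 + ‖x‖) := by
    have h2 : ‖x - p‖ < 1 := by simpa [dist_eq_norm] using hx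
    have h3 := norm_sub_norm_le p x
    rw [norm_sub_rev] at h3
    linarith [norm_nonneg x]
  have hp : 0 < 1 + ‖p‖ := by positivity
  have e : (1 + ‖p‖) ^ (-((n : ℝ) + 1)) = ((1 + ‖p‖) ^ (n + 1))⁻¹ := by
    rw [Real.rpow_neg hp.le]
    norm_cast
  rw [e, ← div_eq_mul_inv, le_div_iff₀ (by positivity)]
  calc ‖Φ x‖ * (1 + ‖p‖) ^ (n + 1) ≤ ‖Φ x‖ * (2 * (1 + ‖x‖)) ^ (n + 1) := by gcongr
    _ = ((1 + ‖x‖) ^ (n + 1) * ‖Φ x‖) * 2 ^ (n + 1) := by rw [mul_pow]; ring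
    _ ≤ C₀ * 2 ^ (n + 1) := by gcongr; exact hdecay x

lemma smul_mem_ball_one_iff {a : ℝ} (ha : 0 < a) (z p : Space n) :
    a • z ∈ Metric.ball p 1 ↔ z ∈ Metric.ball (a⁻¹ • p) a⁻¹ := by
  have hz : z - a⁻¹ • p = a⁻¹ • (a • z - p) := by
    rw [smul_sub, smul_smul, inv_mul_cancel₀ ha.ne', one_smul]
  rw [Metric.mem_ball, Metric.mem_ball, dist_eq_norm, dist_eq_norm, hz, norm_smul,
    Real.norm_of_nonneg (by positivity), mul_lt_iff_lt_one_right (by positivity)]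

lemma indicator_ball_comm (φ : Space n → ℝ≥0∞) (x p : Space n) :
    (Metric.ball p 1).indicator (fun _ => φ p) x = (Metric.ball x 1).indicator φ p := by
  simp only [Set.indicator, Metric.mem_ball, dist_comm]

lemma volume_mul_le_lintegral_indicator {a : ℝ≥0∞} {φ : Space n → ℝ≥0∞} (hφ : Measurable φ)
    (x : Space n) (hle : ∀ p, x ∈ Metric.ball p 1 → a ≤ φ p) :
    volume (Metric.ball (0 : Space n) 1) * a ≤
      ∫⁻ p, (Metric.ball p 1).indicator (fun _ => φ p) x := by
  simp_rw [indicator_ball_comm]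
  rw [lintegral_indicator measurableSet_ball, ← Measure.addHaar_ball_center volume x,
    mul_comm, ← setLIntegral_const]
  exact setLIntegral_mono hφ fun p hp => hle p (by rwa [Metric.mem_ball_comm])

/-- The dilated kernel is dominated by a superposition of indicators of balls of radius `1/(2l)`, so
its average is a superposition of translated ball averages, with integrable weight `φ`. -/
lemma volume_mul_kernelAverage_le {l : ℝ} (hl : 0 < l) (Φ : 𝓢(Space n, ℂ)) {v : Space n → Val m}
    (hv : Measurable v) {φ : Space n → ℝ≥0∞} (hφ : Measurable φ)
    (hle : ∀ x p, x ∈ Metric.ball p 1 → ‖Φ x‖ₑ ≤ φ p) (y : Space n) :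
    volume (Metric.ball (0 : Space n) 1) * kernelAverage l Φ v y ≤
      ∫⁻ p, φ p * ballAverage l v (y - (2 * l)⁻¹ • p) := by
  have hΦ : Measurable Φ := Φ.continuous.measurable
  have hset : MeasurableSet {q : Space n × Space n | (2 * l) • q.1 ∈ Metric.ball q.2 1} := by
    have : IsOpen {q : Space n × Space n | dist ((2 * l) • q.1) q.2 < 1} :=
      isOpen_lt (by fun_prop) (by fun_prop)
    exact this.measurableSet
  have hm : Measurable fun q : Space n × Space n =>
      (Metric.ball q.2 1).indicator (fun _ => φ q.2) ((2 * l) • q.1) :=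
    Measurable.indicator (f := fun q : Space n × Space n => φ q.2) (by fun_prop) hset
  have hv2 : Measurable fun q : Space n × Space n => ‖v (y - q.1)‖ₑ := by fun_prop
  have hm2 : Measurable (Function.uncurry fun z p : Space n => ENNReal.ofReal ((2 * l) ^ n) *
      (Metric.ball p 1).indicator (fun _ => φ p) ((2 * l) • z) * ‖v (y - z)‖ₑ) :=
    (hm.const_mul _).mul hv2
  calc volume (Metric.ball (0 : Space n) 1) * kernelAverage l Φ v y
      = ∫⁻ z, ENNReal.ofReal ((2 * l) ^ n) *
          (volume (Metric.ball (0 : Space n) 1) * ‖Φ ((2 * l) • z)‖ₑ) * ‖v (y - z)‖ₑ := by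
        rw [kernelAverage, ← lintegral_const_mul _ (by fun_prop)]
        exact lintegral_congr fun z => by ring
    _ ≤ ∫⁻ z, ENNReal.ofReal ((2 * l) ^ n) *
          (∫⁻ p, (Metric.ball p 1).indicator (fun _ => φ p) ((2 * l) • z)) * ‖v (y - z)‖ₑ := by
        gcongr
        exact volume_mul_le_lintegral_indicator hφ _ (hle _)
    _ = ∫⁻ z, ∫⁻ p, ENNReal.ofReal ((2 * l) ^ n) *
          (Metric.ball p 1).indicator (fun _ => φ p) ((2 * l) • z) * ‖v (y - z)‖ₑ := by
        congr with z
        have hz : Measurable fun p => (Metric.ball p 1).indicator (fun _ => φ p) ((2 * l) • z) := by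
          simp_rw [indicator_ball_comm]
          exact hφ.indicator measurableSet_ball
        rw [lintegral_mul_const _ (hz.const_mul _), lintegral_const_mul _ hz]
    _ = ∫⁻ p, ∫⁻ z, ENNReal.ofReal ((2 * l) ^ n) *
          (Metric.ball p 1).indicator (fun _ => φ p) ((2 * l) • z) * ‖v (y - z)‖ₑ := by
        rw [lintegral_lintegral_swap hm2.aemeasurable]
    _ = ∫⁻ p, φ p * ballAverage l v (y - (2 * l)⁻¹ • p) := by
        refine lintegral_congr fun p => ?_
        have e : ∀ z, ENNReal.ofReal ((2 * l) ^ n) *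
            (Metric.ball p 1).indicator (fun _ => φ p) ((2 * l) • z) * ‖v (y - z)‖ₑ =
            (ENNReal.ofReal ((2 * l) ^ n) * φ p) *
              (Metric.ball ((2 * l)⁻¹ • p) (2 * l)⁻¹).indicator (fun z => ‖v (y - z)‖ₑ) z := by
          intro z
          have hiff := smul_mem_ball_one_iff (a := 2 * l) (by positivity) z p
          by_cases h : z ∈ Metric.ball ((2 * l)⁻¹ • p) (2 * l)⁻¹
          · rw [Set.indicator_of_mem h, Set.indicator_of_mem (hiff.2 h)]
          · rw [Set.indicator_of_notMem h, Set.indicator_of_notMem (mt hiff.1 h)]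
            simp
        simp_rw [e]
        rw [lintegral_const_mul _ (Measurable.indicator (by fun_prop) measurableSet_ball),
          lintegral_indicator measurableSet_ball, lintegral_ball_eq (f := fun w => ‖v w‖ₑ),
          ballAverage, lintegral_ball_eq (f := fun w => ‖v w‖ₑ), sub_zero]
        ring

/-- Convolutions with dilated Schwartz functions are controlled along admissible curves. -/
theorem exists_lintegral_kernelAverage_le (Φ : 𝓢(Space n, ℂ)) :
    ∃ C : ℝ≥0∞, C ≠ ⊤ ∧ ∀ {m : ℕ} {ν : Measure ℝ} {γ : ℝ → Space n}, Admissible ν γ →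
      ∀ (l : ℝ) (v : Space n → Val m), 1 ≤ l → Measurable v → ∀ y,
        ∫⁻ t, kernelAverage l Φ v (y + γ t) ∂ν ≤ C * (ballConst n l * dlNorm l v) := by
  obtain ⟨φ, hφ, hfin, hle⟩ := exists_integrable_local_bound Φ
  have hb0 : volume (Metric.ball (0 : Space n) 1) ≠ 0 :=
    (Metric.measure_ball_pos volume _ one_pos).ne'
  have hbt : volume (Metric.ball (0 : Space n) 1) ≠ ⊤ := measure_ball_lt_top.ne
  refine ⟨(volume (Metric.ball (0 : Space n) 1))⁻¹ * ∫⁻ p, φ p,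
    ENNReal.mul_ne_top (ENNReal.inv_ne_top.2 hb0) hfin, fun {m ν γ} had l v hl hv y => ?_⟩
  have := had.sfinite
  have hl0 : 0 < l := by linarith
  have h1 : ∀ x, kernelAverage l Φ v x ≤ (volume (Metric.ball (0 : Space n) 1))⁻¹ *
      ∫⁻ p, φ p * ballAverage l v (x - (2 * l)⁻¹ • p) := fun x => by
    have h2 := mul_le_mul_right (volume_mul_kernelAverage_le hl0 Φ hv hφ hle x)
      (volume (Metric.ball (0 : Space n) 1))⁻¹
    rwa [← mul_assoc, ENNReal.inv_mul_cancel hb0 hbt, one_mul] at h2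
  calc ∫⁻ t, kernelAverage l Φ v (y + γ t) ∂ν
      ≤ ∫⁻ t, (volume (Metric.ball (0 : Space n) 1))⁻¹ *
          (∫⁻ p, φ p * ballAverage l v (y + γ t - (2 * l)⁻¹ • p)) ∂ν :=
        lintegral_mono fun t => h1 _
    _ = (volume (Metric.ball (0 : Space n) 1))⁻¹ *
          ∫⁻ t, (∫⁻ p, φ p * ballAverage l v (y + γ t - (2 * l)⁻¹ • p)) ∂ν := by
        rw [lintegral_const_mul' _ _ (ENNReal.inv_ne_top.2 hb0)]
    _ ≤ (volume (Metric.ball (0 : Space n) 1))⁻¹ *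
          ((∫⁻ p, φ p) * (ballConst n l * dlNorm l v)) := by
        gcongr
        exact lintegral_conv_le had.measurable (measurable_ballAverage l hv) hφ
          (τ := fun p => (2 * l)⁻¹ • p) (by fun_prop) (had.le m l v hl hv) y
    _ = _ := by ring

end Balls

end DerivNLS
end

noncomputable section

namespace DerivNLS

open scoped LineDeriv
open Cutoff

/-! ### Littlewood-Paley kernels and their scaling -/

section Kernels

variable {n : ℕ}

/-- The dilation `x ↦ ε⁻ⁿ f(ε⁻¹ x)`, which preserves the integral. -/
def scaled (ε : ℝ) (hε : 0 < ε) (f : 𝓢(Space n, ℂ)) : 𝓢(Space n, ℂ) :=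
  (((ε ^ n)⁻¹ : ℝ) : ℂ) • dilate ε hε f

lemma scaled_apply (ε : ℝ) (hε : 0 < ε) (f : 𝓢(Space n, ℂ)) (x : Space n) :
    scaled ε hε f x = (((ε ^ n)⁻¹ : ℝ) : ℂ) * f (ε⁻¹ • x) := rfl

lemma fourier_scaled (ε : ℝ) (hε : 0 < ε) (f : 𝓢(Space n, ℂ)) (ξ : Space n) :
    𝓕 (scaled ε hε f) ξ = 𝓕 f (ε • ξ) := by
  rw [SchwartzMap.fourier_coe, SchwartzMap.fourier_coe, Real.fourier_eq, Real.fourier_eq]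
  have h := Measure.integral_comp_inv_smul (μ := (volume : Measure (Space n)))
    (fun v => Real.fourierChar (-inner ℝ v (ε • ξ)) • f v) ε
  have e : ∀ v : Space n, Real.fourierChar (-inner ℝ v ξ) • scaled ε hε f v =
      (((ε ^ n)⁻¹ : ℝ) : ℂ) •
        (Real.fourierChar (-inner ℝ (ε⁻¹ • v) (ε • ξ)) • f (ε⁻¹ • v)) := by
    intro v
    rw [scaled_apply, real_inner_smul_left, real_inner_smul_right, ← mul_assoc,
      inv_mul_cancel₀ hε.ne', one_mul, smul_comm, smul_eq_mul (((ε ^ n)⁻¹ : ℝ) : ℂ)]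
  simp_rw [e]
  rw [integral_smul, h, finrank_euclideanSpace_fin, abs_of_pos (by positivity), Complex.real_smul,
    smul_eq_mul, ← mul_assoc, ← Complex.ofReal_mul, inv_mul_cancel₀ (by positivity),
    Complex.ofReal_one, one_mul]

lemma lineDerivOp_scaled (ε : ℝ) (hε : 0 < ε) (f : 𝓢(Space n, ℂ)) (v : Space n) :
    ∂_{v} (scaled ε hε f) = ((ε⁻¹ : ℝ) : ℂ) • scaled ε hε (∂_{v} f) := by
  rw [scaled, LineDeriv.lineDerivOp_smul, dilate,
    SchwartzMap.lineDerivOp_compCLMOfContinuousLinearEquiv]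
  have : (ContinuousLinearEquiv.smulLeft (Units.mk0 ε⁻¹ (inv_ne_zero hε.ne')) :
      Space n ≃L[ℝ] Space n) v = ε⁻¹ • v := rfl
  rw [this, LineDeriv.lineDerivOp_left_smul]
  ext x
  change (((ε ^ n)⁻¹ : ℝ) : ℂ) * (ε⁻¹ • (∂_{v} f) (ε⁻¹ • x)) =
    ((ε⁻¹ : ℝ) : ℂ) * ((((ε ^ n)⁻¹ : ℝ) : ℂ) * (∂_{v} f) (ε⁻¹ • x))
  rw [Complex.real_smul, mul_left_comm]

lemma lintegral_enorm_scaled (ε : ℝ) (hε : 0 < ε) (f : 𝓢(Space n, ℂ)) :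
    ∫⁻ x, ‖scaled ε hε f x‖ₑ = ∫⁻ x, ‖f x‖ₑ := by
  rw [← ofReal_integral_norm_eq_lintegral_enorm (scaled ε hε f).integrable,
    ← ofReal_integral_norm_eq_lintegral_enorm f.integrable]
  congr 1
  have h := Measure.integral_comp_inv_smul (μ := (volume : Measure (Space n))) (fun v => ‖f v‖) ε
  simp_rw [scaled_apply, norm_mul]
  rw [integral_const_mul, h, finrank_euclideanSpace_fin, Complex.norm_real,
    Real.norm_of_nonneg (by positivity), abs_of_pos (by positivity), smul_eq_mul, ← mul_assoc,
    inv_mul_cancel₀ (by positivity), one_mul]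

/-- Iterated partial derivatives of a Schwartz function. -/
def listDeriv (L : List (Fin n)) (K : 𝓢(Space n, ℂ)) : 𝓢(Space n, ℂ) :=
  L.foldr (fun i f => ∂_{EuclideanSpace.single i (1 : ℝ)} f) K

lemma listDeriv_cons (i : Fin n) (L : List (Fin n)) (K : 𝓢(Space n, ℂ)) :
    listDeriv (i :: L) K = ∂_{EuclideanSpace.single i (1 : ℝ)} (listDeriv L K) := rfl

lemma listDeriv_scaled (L : List (Fin n)) (ε : ℝ) (hε : 0 < ε) (f : 𝓢(Space n, ℂ)) :
    listDeriv L (scaled ε hε f) = (((ε⁻¹) ^ L.length : ℝ) : ℂ) • scaled ε hε (listDeriv L f) := by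
  induction L with
  | nil => simp [listDeriv]
  | cons i L ih =>
    rw [listDeriv_cons, ih, LineDeriv.lineDerivOp_smul, lineDerivOp_scaled, smul_smul,
      listDeriv_cons, List.length_cons, pow_succ, Complex.ofReal_mul]

lemma listDeriv_sum {ι : Type*} (L : List (Fin n)) (s : Finset ι) (f : ι → 𝓢(Space n, ℂ)) :
    listDeriv L (∑ j ∈ s, f j) = ∑ j ∈ s, listDeriv L (f j) := by
  induction L with
  | nil => rfl
  | cons i L ih => rw [listDeriv_cons, ih, LineDeriv.lineDerivOp_sum]; rfl

lemma IsConv.listDeriv_right {A B D : 𝓢(Space n, ℂ)} (h : IsConv A B D) (L : List (Fin n)) :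
    IsConv A (listDeriv L B) (listDeriv L D) := by
  induction L with
  | nil => exact h
  | cons i L ih => exact ih.lineDerivOp_right _

lemma IsConv.listDeriv_left {A B D : 𝓢(Space n, ℂ)} (h : IsConv A B D) (L : List (Fin n)) :
    IsConv (listDeriv L A) B (listDeriv L D) :=
  (h.symm.listDeriv_right L).symm

namespace Cutoff

variable (χ : Cutoff n)

lemma fourier_kernel (j : ℕ) (ξ : Space n) : 𝓕 (χ.kernel j) ξ = χ.multiplier j ξ := by
  have h : 𝓕 (χ.kernel j) =
      (χ.hasCompactSupport_multiplier j).toSchwartzMap (χ.contDiff_multiplier j) :=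
    FourierTransform.fourier_fourierInv_eq _
  rw [h]
  rfl

lemma multiplier_eq_one {j : ℕ} {ξ : Space n} (h : ‖(2 * Real.pi / 2 ^ j : ℝ) • ξ‖ ≤ 1) :
    χ.multiplier j ξ = 1 := by
  rw [multiplier, χ.eq_one _ h, Complex.ofReal_one]

lemma multiplier_eq_zero {j : ℕ} {ξ : Space n} (h : 2 ≤ ‖(2 * Real.pi / 2 ^ j : ℝ) • ξ‖) :
    χ.multiplier j ξ = 0 := by
  rw [multiplier, χ.eq_zero _ h, Complex.ofReal_zero]

lemma kernel_eq_scaled (j : ℕ) :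
    χ.kernel j = scaled ((2 : ℝ) ^ j)⁻¹ (by positivity) (χ.kernel 0) := by
  refine eq_of_fourier_eq fun ξ => ?_
  rw [fourier_scaled, fourier_kernel, fourier_kernel, multiplier, multiplier, smul_smul]
  congr 3
  simp [div_eq_mul_inv]

/-- The convolution kernel of the dyadic block. -/
def blockKernel : ℕ → 𝓢(Space n, ℂ)
  | 0 => χ.kernel 0
  | j + 1 => χ.kernel (j + 1) - χ.kernel j

lemma sum_blockKernel (J : ℕ) : ∑ j ∈ Finset.range (J + 1), χ.blockKernel j = χ.kernel J := by
  induction J with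
  | zero => simp [blockKernel]
  | succ J ih => rw [Finset.sum_range_succ, ih, blockKernel, add_sub_cancel]

lemma norm_dyadic_smul (j i : ℕ) (ξ : Space n) :
    ‖(2 * Real.pi / 2 ^ j : ℝ) • ξ‖ = 2 ^ i * ‖(2 * Real.pi / 2 ^ (j + i) : ℝ) • ξ‖ := by
  rw [norm_smul, norm_smul, Real.norm_of_nonneg (by positivity),
    Real.norm_of_nonneg (by positivity), pow_add]
  field_simp

/-- The reproducing formula: `χ(D / 2^(j+1))` is the identity on the frequencies `|ξ| ≤ 2 · 2^j` of
the block. This is why averages are taken at scale `1/(2l)`. -/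
lemma isConv_blockKernel (j : ℕ) :
    IsConv (χ.kernel (j + 1)) (χ.blockKernel j) (χ.blockKernel j) := by
  intro ξ
  rcases le_or_gt ‖(2 * Real.pi / 2 ^ (j + 1) : ℝ) • ξ‖ 1 with h | h
  · rw [fourier_kernel, χ.multiplier_eq_one h, one_mul]
  · have h0 : 𝓕 (χ.blockKernel j) ξ = 0 := by
      have hj : χ.multiplier j ξ = 0 := χ.multiplier_eq_zero (by
        rw [norm_dyadic_smul j 1]; linarith)
      cases j with
      | zero => rw [blockKernel, fourier_kernel, hj]
      | succ j =>
        have hj' : χ.multiplier j ξ = 0 := χ.multiplier_eq_zero (by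
          rw [norm_dyadic_smul j 2]; linarith)
        have : 𝓕 (χ.kernel (j + 1) - χ.kernel j) = 𝓕 (χ.kernel (j + 1)) - 𝓕 (χ.kernel j) := by
          simp [sub_eq_add_neg, FourierTransform.fourier_add]
        rw [blockKernel, this, sub_apply, fourier_kernel, fourier_kernel, hj, hj', sub_zero]
    rw [h0, mul_zero]

/-- `χ(εD)` lives on `|ξ| ≤ 2/ε ≤ 2^J`, where `χ(D / 2^J)` is the identity; hence only blocks up to
`J` matter. -/
lemma isConv_scaled_kernel {ε : ℝ} (hε : 0 < ε) {J : ℕ} (hJ : 2 ≤ ε * 2 ^ J) :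
    IsConv (scaled ε hε (χ.kernel 0)) (χ.kernel J) (scaled ε hε (χ.kernel 0)) := by
  intro ξ
  rw [fourier_scaled, fourier_kernel, fourier_kernel]
  rcases le_or_gt ‖(2 * Real.pi / 2 ^ J : ℝ) • ξ‖ 1 with h | h
  · rw [χ.multiplier_eq_one h, mul_one]
  · have h0 : χ.multiplier 0 (ε • ξ) = 0 := χ.multiplier_eq_zero (by
      have e : ‖(2 * Real.pi / 2 ^ 0 : ℝ) • ε • ξ‖ =
          ε * 2 ^ J * ‖(2 * Real.pi / 2 ^ J : ℝ) • ξ‖ := by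
        rw [norm_smul, norm_smul, norm_smul, Real.norm_of_nonneg (by positivity),
          Real.norm_of_nonneg hε.le, Real.norm_of_nonneg (by positivity)]
        field_simp
      rw [e]
      nlinarith)
    rw [h0, zero_mul]

end Cutoff

end Kernels

/-! ### Blocks and rescaling of distributions as convolutions -/

section Dist

variable {n m : ℕ}

/-- A tempered distribution as a continuous linear map. -/
def distCLM (u : 𝓢'(Space n, Val m)) : 𝓢(Space n, ℂ) →L[ℂ] Val m := u

lemma block_eq_smear (χ : Cutoff n) (j : ℕ) (u : 𝓢'(Space n, Val m)) :
    χ.block j u = smear (distCLM u) (χ.blockKernel j) := by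
  cases j with
  | zero => rfl
  | succ j =>
    funext x
    rw [smear, Cutoff.blockKernel, reflectAt_sub, map_sub]
    rfl

lemma smear_rescale (ε : ℝ) (hε : 0 < ε) (u : 𝓢'(Space n, Val m)) (K : 𝓢(Space n, ℂ))
    (x : Space n) :
    smear (distCLM (rescale ε hε u)) K x =
      (ε : ℂ) • smear (distCLM u) (scaled ε hε K) (ε • x) := by
  have e : dilate ε hε (reflectAt K x) = reflectAt (dilate ε hε K) (ε • x) := by
    ext y
    rw [dilate_apply, reflectAt_apply, reflectAt_apply, dilate_apply, smul_sub, smul_smul,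
      inv_mul_cancel₀ hε.ne', one_smul]
  have e2 : smear (distCLM (rescale ε hε u)) K x =
      ((ε * (ε ^ n)⁻¹ : ℝ) : ℂ) • distCLM u (dilate ε hε (reflectAt K x)) := rfl
  rw [e2, e, smear, scaled, reflectAt_smul, map_smul, smul_smul, Complex.ofReal_mul]

end Dist

end DerivNLS
end

noncomputable section

namespace DerivNLS

open scoped LineDeriv
open Cutoff

/-! ### Summation over dyadic blocks -/

section Bounds

variable {n m : ℕ}

lemma dlNorm_block_le (χ : Cutoff n) (s : ℝ) (u : 𝓢'(Space n, Val m)) (j : ℕ) :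
    dlNorm (2 ^ j) (χ.block j u) ≤ ENNReal.ofReal (((2 : ℝ) ^ j) ^ (-s)) * dhNorm χ s u := by
  have h1 : ENNReal.ofReal (((2 : ℝ) ^ j) ^ (2 * s)) * dlNorm (2 ^ j) (χ.block j u) ^ 2 ≤
      ∑' j : ℕ, ENNReal.ofReal (((2 : ℝ) ^ j) ^ (2 * s)) * dlNorm (2 ^ j) (χ.block j u) ^ 2 :=
    ENNReal.le_tsum j
  have h2 := ENNReal.rpow_le_rpow h1 (show (0 : ℝ) ≤ 1 / 2 by norm_num)
  have hp : (0 : ℝ) < 2 ^ j := by positivity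
  rw [ENNReal.mul_rpow_of_nonneg _ _ (by norm_num),
    ENNReal.ofReal_rpow_of_pos (Real.rpow_pos_of_pos hp _), ← Real.rpow_mul hp.le,
    ← ENNReal.rpow_natCast, ← ENNReal.rpow_mul] at h2
  have e1 : 2 * s * (1 / 2) = s := by ring
  have e2 : ((2 : ℕ) : ℝ) * (1 / 2) = 1 := by norm_num
  rw [e1, e2, ENNReal.rpow_one] at h2
  calc dlNorm (2 ^ j) (χ.block j u)
      = ENNReal.ofReal (((2 : ℝ) ^ j) ^ (-s)) *
          (ENNReal.ofReal (((2 : ℝ) ^ j) ^ s) * dlNorm (2 ^ j) (χ.block j u)) := by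
        rw [← mul_assoc, ← ENNReal.ofReal_mul (by positivity), ← Real.rpow_add hp]
        simp
    _ ≤ _ := by
        gcongr
        exact h2

lemma ballConst_eq {l : ℝ} (hl : 0 < l) :
    ballConst n l = ballConst n 1 * ENNReal.ofReal (l ^ ((n : ℝ) / 2)) := by
  have e : ENNReal.ofReal (l ^ ((n : ℝ) / 2)) = ENNReal.ofReal (l ^ n) ^ (1 / 2 : ℝ) := by
    rw [ENNReal.ofReal_rpow_of_pos (by positivity), ← Real.rpow_natCast, ← Real.rpow_mul hl.le]
    congr 2
    ring
  rw [e, ballConst, ballConst, ← ENNReal.mul_rpow_of_nonneg _ _ (by norm_num), mul_pow,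
    ENNReal.ofReal_mul (by positivity), mul_one]
  congr 1
  ring

lemma ballConst_ne_top (l : ℝ) : ballConst n l ≠ ⊤ :=
  ENNReal.rpow_ne_top_of_nonneg (by norm_num)
    (ENNReal.mul_ne_top ENNReal.ofReal_ne_top measure_ball_lt_top.ne)

/-- All derivatives fall on the reproducing kernel, at a cost of `2 · 2^j` each, and the block
itself stays undifferentiated. -/
lemma enorm_smear_blockKernel_le (χ : Cutoff n) (u : 𝓢'(Space n, Val m)) (L : List (Fin n))
    (j : ℕ) (y : Space n) :
    ‖smear (distCLM u) (listDeriv L (χ.blockKernel j)) y‖ₑ ≤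
      ENNReal.ofReal ((2 * 2 ^ j) ^ L.length) *
        kernelAverage (2 ^ j) (listDeriv L (χ.kernel 0)) (χ.block j u) y := by
  rw [((χ.isConv_blockKernel j).listDeriv_left L).smear_eq, kernelAverage,
    ← lintegral_const_mul' _ _ ENNReal.ofReal_ne_top]
  refine (enorm_integral_le_lintegral_enorm _).trans (lintegral_mono fun z => ?_)
  rw [enorm_smul, block_eq_smear, ← mul_assoc, χ.kernel_eq_scaled (j + 1), listDeriv_scaled,
    smul_apply, scaled_apply, smul_eq_mul, enorm_mul, enorm_mul, inv_inv, pow_succ',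
    inv_pow, inv_inv, ← mul_assoc, ← mul_assoc]
  rw [← ofReal_norm (((_ : ℝ) : ℂ)), ← ofReal_norm (((_ : ℝ) : ℂ)), Complex.norm_real,
    Complex.norm_real, Real.norm_of_nonneg (by positivity), Real.norm_of_nonneg (by positivity)]

/-- The derivatives are put on the blocks, and the outer kernel of `χ(εD)` enters only through its
`L¹` norm, which does not depend on `ε`. -/
lemma lintegral_smear_scaled_le (χ : Cutoff n) (L : List (Fin n)) :
    ∃ C : ℝ≥0∞, C ≠ ⊤ ∧ ∀ {m : ℕ} (u : 𝓢'(Space n, Val m)) {ν : Measure ℝ} {γ : ℝ → Space n},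
      Admissible ν γ → ∀ {ε : ℝ} (hε : 0 < ε) {J : ℕ}, 2 ≤ ε * 2 ^ J → ∀ y,
        ∫⁻ t, ‖smear (distCLM u) (listDeriv L (scaled ε hε (χ.kernel 0))) (y + γ t)‖ₑ ∂ν ≤
          C * ∑ j ∈ Finset.range (J + 1), ENNReal.ofReal ((2 * 2 ^ j) ^ L.length) *
            (ballConst n (2 ^ j) * dlNorm (2 ^ j) (χ.block j u)) := by
  obtain ⟨C, hC, hbound⟩ := exists_lintegral_kernelAverage_le (listDeriv L (χ.kernel 0))
  refine ⟨(∫⁻ x, ‖χ.kernel 0 x‖ₑ) * C, ENNReal.mul_ne_top (χ.kernel 0).integrable.2.ne hC,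
    fun {m} u {ν γ} had {ε} hε {J} hJ y => ?_⟩
  have := had.sfinite
  have hv : ∀ j, Measurable (χ.block j u) := fun j => by
    rw [block_eq_smear]
    exact (continuous_smear _ _).measurable
  set f : Space n → ℝ≥0∞ := fun x => ∑ j ∈ Finset.range (J + 1),
    ENNReal.ofReal ((2 * 2 ^ j) ^ L.length) *
      kernelAverage (2 ^ j) (listDeriv L (χ.kernel 0)) (χ.block j u) x with hf
  have hkm : ∀ j, Measurable (kernelAverage (2 ^ j) (listDeriv L (χ.kernel 0)) (χ.block j u)) :=
    fun j => measurable_kernelAverage _ _ (hv j)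
  have hfm : Measurable f :=
    Finset.measurable_fun_sum _ fun j _ => (hkm j).const_mul _
  have h1 : ∀ x, ‖smear (distCLM u) (listDeriv L (χ.kernel J)) x‖ₑ ≤ f x := by
    intro x
    have e : smear (distCLM u) (listDeriv L (χ.kernel J)) x = ∑ j ∈ Finset.range (J + 1),
        smear (distCLM u) (listDeriv L (χ.blockKernel j)) x := by
      rw [← χ.sum_blockKernel, listDeriv_sum]
      simp [smear, reflectAt]
    rw [e]
    exact (enorm_sum_le _ _).trans (Finset.sum_le_sum fun j _ => enorm_smear_blockKernel_le χ u L j x)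
  have h2 : ∀ y, ∫⁻ t, f (y + γ t) ∂ν ≤ C * ∑ j ∈ Finset.range (J + 1),
      ENNReal.ofReal ((2 * 2 ^ j) ^ L.length) *
        (ballConst n (2 ^ j) * dlNorm (2 ^ j) (χ.block j u)) := by
    intro y
    have hγ := had.measurable
    have hkγ : ∀ j, Measurable fun t =>
        kernelAverage (2 ^ j) (listDeriv L (χ.kernel 0)) (χ.block j u) (y + γ t) :=
      fun j => (hkm j).comp (by fun_prop)
    simp only [hf]
    rw [lintegral_finsetSum _ fun j _ => (hkγ j).const_mul _, Finset.mul_sum]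
    refine Finset.sum_le_sum fun j _ => ?_
    rw [lintegral_const_mul _ (hkγ j), mul_left_comm C]
    gcongr
    exact hbound had _ _ (one_le_pow₀ (by norm_num)) (hv j) y
  have h3 : ∀ x, ‖smear (distCLM u) (listDeriv L (scaled ε hε (χ.kernel 0))) x‖ₑ ≤
      ∫⁻ z, ‖scaled ε hε (χ.kernel 0) z‖ₑ * f (x - z) := by
    intro x
    rw [((χ.isConv_scaled_kernel hε hJ).listDeriv_right L).smear_eq]
    refine (enorm_integral_le_lintegral_enorm _).trans (lintegral_mono fun z => ?_)
    rw [enorm_smul]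
    gcongr
    exact h1 _
  calc _ ≤ ∫⁻ t, (∫⁻ z, ‖scaled ε hε (χ.kernel 0) z‖ₑ * f (y + γ t - z)) ∂ν :=
        lintegral_mono fun t => h3 _
    _ ≤ _ := by
        refine (lintegral_conv_le had.measurable hfm
          (scaled ε hε (χ.kernel 0)).continuous.measurable.enorm measurable_id h2 y).trans_eq ?_
        rw [lintegral_enorm_scaled, mul_assoc]

/-- With `x = ε 2^j / 4 ≤ 1` the left power is `(8x)^q`, and `x^q ≤ x^σ`. The surplus `2ρ` in `s`
covers `2^(jσ)` and leaves the geometric factor `2^(-ρj)`. -/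
lemma dyadic_weight_le {ε σ ρ : ℝ} (hε : 0 < ε) (hσ : 0 ≤ σ) (hσρ : σ ≤ ρ) {q j : ℕ}
    (hσq : σ ≤ q) (hj : ε * 2 ^ j ≤ 4) (s a : ℝ) (hs : a + 2 * ρ ≤ s) :
    ε ^ q * ((2 * 2 ^ j) ^ q * (((2 : ℝ) ^ j) ^ a * ((2 : ℝ) ^ j) ^ (-s))) ≤
      8 ^ q * ε ^ σ * ((2 : ℝ) ^ (-ρ)) ^ j := by
  have hp : (0 : ℝ) < 2 ^ j := by positivity
  set x : ℝ := ε * 2 ^ j / 4 with hx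
  have hx0 : 0 < x := by positivity
  have hx1 : x ≤ 1 := by rw [hx]; linarith
  have h1 : x ^ q ≤ ε ^ σ * ((2 : ℝ) ^ j) ^ σ := by
    rw [← Real.mul_rpow hε.le hp.le, ← Real.rpow_natCast]
    refine (Real.rpow_le_rpow_of_exponent_ge hx0 hx1 hσq).trans ?_
    refine Real.rpow_le_rpow hx0.le ?_ hσ
    rw [hx]
    have : 0 < ε * 2 ^ j := by positivity
    linarith
  have h2 : ((2 : ℝ) ^ j) ^ σ * (((2 : ℝ) ^ j) ^ a * ((2 : ℝ) ^ j) ^ (-s)) ≤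
      ((2 : ℝ) ^ (-ρ)) ^ j := by
    rw [← Real.rpow_add hp, ← Real.rpow_add hp, ← Real.rpow_natCast (2 ^ (-ρ)),
      ← Real.rpow_mul (by norm_num), mul_comm (-ρ), Real.rpow_mul (by norm_num),
      Real.rpow_natCast]
    exact Real.rpow_le_rpow_of_exponent_le (one_le_pow₀ (by norm_num)) (by linarith)
  calc ε ^ q * ((2 * 2 ^ j) ^ q * (((2 : ℝ) ^ j) ^ a * ((2 : ℝ) ^ j) ^ (-s)))
      = 8 ^ q * (x ^ q * (((2 : ℝ) ^ j) ^ a * ((2 : ℝ) ^ j) ^ (-s))) := by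
        have : ε ^ q * (2 * 2 ^ j) ^ q = 8 ^ q * x ^ q := by
          rw [← mul_pow, ← mul_pow, hx]
          congr 1
          ring
        rw [← mul_assoc, this, mul_assoc]
    _ ≤ 8 ^ q * ((ε ^ σ * ((2 : ℝ) ^ j) ^ σ) * (((2 : ℝ) ^ j) ^ a * ((2 : ℝ) ^ j) ^ (-s))) := by
        gcongr
    _ = 8 ^ q * ε ^ σ *
          (((2 : ℝ) ^ j) ^ σ * (((2 : ℝ) ^ j) ^ a * ((2 : ℝ) ^ j) ^ (-s))) := by ring
    _ ≤ _ := by gcongr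

lemma exists_dyadic_scale {ε : ℝ} (hε : 0 < ε) (hε1 : ε ≤ 1) :
    ∃ J : ℕ, 2 ≤ ε * 2 ^ J ∧ ε * 2 ^ J ≤ 4 := by
  obtain ⟨k, hk1, hk2⟩ := exists_nat_pow_near (x := 2 / ε) (y := 2)
    (by rw [le_div_iff₀ hε]; linarith) (by norm_num)
  rw [le_div_iff₀ hε] at hk1
  rw [div_lt_iff₀ hε] at hk2
  refine ⟨k + 1, by linarith, ?_⟩
  rw [pow_succ]
  linarith

/-- Bounds for the derivatives of the low frequency part along admissible curves. -/
theorem exists_lintegral_listDeriv_le (χ : Cutoff n) {s ρ : ℝ} (hρ : 0 < ρ)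
    (hs : (n : ℝ) / 2 + 2 * ρ ≤ s) (L : List (Fin n)) :
    ∃ C : ℝ, 0 ≤ C ∧ ∀ {m : ℕ} (u : 𝓢'(Space n, Val m)) {ν : Measure ℝ} {γ : ℝ → Space n},
      Admissible ν γ → ∀ {ε : ℝ} (hε : 0 < ε), ε ≤ 1 → ∀ {σ : ℝ}, 0 ≤ σ → σ ≤ ρ →
        σ ≤ L.length → ∀ y,
        ENNReal.ofReal (ε ^ L.length) *
          ∫⁻ t, ‖smear (distCLM u) (listDeriv L (scaled ε hε (χ.kernel 0))) (y + γ t)‖ₑ ∂ν ≤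
          ENNReal.ofReal (C * ε ^ σ) * dhNorm χ s u := by
  obtain ⟨C₁, hC₁, hbound⟩ := lintegral_smear_scaled_le χ L
  set r : ℝ := 2 ^ (-ρ) with hr
  have hr0 : 0 < r := Real.rpow_pos_of_pos (by norm_num) _
  have hr1 : r < 1 := Real.rpow_lt_one_of_one_lt_of_neg (by norm_num) (by linarith)
  have hsum : Summable fun j : ℕ => r ^ j := summable_geometric_of_lt_one hr0.le hr1
  refine ⟨(C₁ * ballConst n 1).toReal * (8 ^ L.length * ∑' j : ℕ, r ^ j),
    mul_nonneg ENNReal.toReal_nonneg (mul_nonneg (by positivity)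
      (tsum_nonneg fun j => by positivity)),
    fun {m} u {ν γ} had {ε} hε hε1 {σ} hσ hσρ hσL y => ?_⟩
  obtain ⟨J, hJ1, hJ2⟩ := exists_dyadic_scale hε hε1
  have hterm : ∀ j ∈ Finset.range (J + 1), ENNReal.ofReal (ε ^ L.length) *
      (ENNReal.ofReal ((2 * 2 ^ j) ^ L.length) *
        (ballConst n (2 ^ j) * dlNorm (2 ^ j) (χ.block j u))) ≤
      ballConst n 1 * ENNReal.ofReal (8 ^ L.length * ε ^ σ * r ^ j) * dhNorm χ s u := by
    intro j hj
    have hj4 : ε * 2 ^ j ≤ 4 := by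
      refine le_trans ?_ hJ2
      have : j ≤ J := by simpa [Nat.lt_succ_iff] using hj
      gcongr
      norm_num
    have hw := dyadic_weight_le hε hσ hσρ hσL hj4 s ((n : ℝ) / 2) hs
    calc _ ≤ ENNReal.ofReal (ε ^ L.length) * (ENNReal.ofReal ((2 * 2 ^ j) ^ L.length) *
          (ballConst n 1 * ENNReal.ofReal (((2 : ℝ) ^ j) ^ ((n : ℝ) / 2)) *
            (ENNReal.ofReal (((2 : ℝ) ^ j) ^ (-s)) * dhNorm χ s u))) := by
          rw [ballConst_eq (by positivity : (0 : ℝ) < 2 ^ j)]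
          gcongr
          exact dlNorm_block_le χ s u j
      _ = ballConst n 1 * (ENNReal.ofReal (ε ^ L.length) *
            (ENNReal.ofReal ((2 * 2 ^ j) ^ L.length) *
            (ENNReal.ofReal (((2 : ℝ) ^ j) ^ ((n : ℝ) / 2)) *
              ENNReal.ofReal (((2 : ℝ) ^ j) ^ (-s))))) * dhNorm χ s u := by ring
      _ ≤ _ := by
          rw [← ENNReal.ofReal_mul (by positivity), ← ENNReal.ofReal_mul (by positivity),
            ← ENNReal.ofReal_mul (by positivity)]
          gcongr
  have hgeom : ∑ j ∈ Finset.range (J + 1), ENNReal.ofReal (8 ^ L.length * ε ^ σ * r ^ j) ≤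
      ENNReal.ofReal (8 ^ L.length * ε ^ σ * ∑' j : ℕ, r ^ j) := by
    rw [← ENNReal.ofReal_sum_of_nonneg fun j _ => by positivity, ← Finset.mul_sum]
    gcongr
    exact hsum.sum_le_tsum _ fun j _ => by positivity
  calc _ ≤ ENNReal.ofReal (ε ^ L.length) * (C₁ * ∑ j ∈ Finset.range (J + 1),
          ENNReal.ofReal ((2 * 2 ^ j) ^ L.length) *
            (ballConst n (2 ^ j) * dlNorm (2 ^ j) (χ.block j u))) := by
        gcongr
        exact hbound u had hε hJ1 y
    _ = C₁ * ∑ j ∈ Finset.range (J + 1), ENNReal.ofReal (ε ^ L.length) *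
          (ENNReal.ofReal ((2 * 2 ^ j) ^ L.length) *
            (ballConst n (2 ^ j) * dlNorm (2 ^ j) (χ.block j u))) := by
        rw [mul_left_comm, Finset.mul_sum]
    _ ≤ C₁ * ∑ j ∈ Finset.range (J + 1),
          ballConst n 1 * ENNReal.ofReal (8 ^ L.length * ε ^ σ * r ^ j) * dhNorm χ s u := by
        exact mul_le_mul_right (Finset.sum_le_sum hterm) _
    _ = C₁ * ballConst n 1 * (∑ j ∈ Finset.range (J + 1),
          ENNReal.ofReal (8 ^ L.length * ε ^ σ * r ^ j)) * dhNorm χ s u := by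
        rw [← Finset.sum_mul, ← Finset.mul_sum]
        ring
    _ ≤ C₁ * ballConst n 1 * ENNReal.ofReal (8 ^ L.length * ε ^ σ * ∑' j : ℕ, r ^ j) *
          dhNorm χ s u := by gcongr
    _ = _ := by
        rw [← ENNReal.ofReal_toReal (ENNReal.mul_ne_top hC₁ (ballConst_ne_top (n := n) 1)),
          ← ENNReal.ofReal_mul ENNReal.toReal_nonneg,
          ENNReal.ofReal_toReal (ENNReal.mul_ne_top hC₁ (ballConst_ne_top (n := n) 1))]
        congr 2
        ring

end Bounds

end DerivNLS
end

noncomputable section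

namespace DerivNLS

open scoped LineDeriv
open Cutoff

/-! ### The symbol and its mixed derivatives -/

section Symbol

variable {n m : ℕ}

lemma norm_conjVal (w : Val m) : ‖conjVal w‖ = ‖w‖ := by
  simp [EuclideanSpace.norm_eq, conjVal]

lemma norm_formSymbol_le (B₀ : GradForm n m) (w : Val m) (ξ : Space n) :
    ‖formSymbol B₀ w ξ‖ ≤ ‖B₀‖ * ‖w‖ * ‖ξ‖ := by
  refine ContinuousLinearMap.opNorm_le_bound _ (by positivity) fun v => ?_
  have h1 : ‖(w, conjVal w)‖ = ‖w‖ := by simp [Prod.norm_def, norm_conjVal]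
  have h2 : ‖fun j : Fin n => ((ξ j : ℝ) : ℂ) • v‖ ≤ ‖ξ‖ * ‖v‖ := by
    refine (pi_norm_le_iff_of_nonneg (by positivity)).2 fun j => ?_
    rw [norm_smul, Complex.norm_real]
    gcongr
    exact PiLp.norm_apply_le ξ j
  calc ‖B₀ (w, conjVal w) fun j : Fin n => ((ξ j : ℝ) : ℂ) • v‖
      ≤ ‖B₀‖ * ‖(w, conjVal w)‖ * ‖fun j : Fin n => ((ξ j : ℝ) : ℂ) • v‖ := B₀.le_opNorm₂ _ _
    _ ≤ ‖B₀‖ * ‖w‖ * (‖ξ‖ * ‖v‖) := by rw [h1]; gcongr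
    _ = _ := by ring

/-- `formSymbol` as a continuous real bilinear map. -/
def formBilin (B₀ : GradForm n m) : Val m →L[ℝ] Space n →L[ℝ] (Val m →L[ℂ] Val m) :=
  LinearMap.mkContinuous₂
    (LinearMap.mk₂ ℝ (formSymbol B₀)
      (fun w w' ξ => by
        have : (w + w', conjVal (w + w')) = (w, conjVal w) + (w', conjVal w') := by
          ext <;> simp [conjVal]
        ext1 v
        simp only [formSymbol, this, map_add]
        rfl)
      -- Conjugation commutes with real scalars only, so bilinearity is over `ℝ`.
      (fun c w ξ => by
        have : (c • w, conjVal (c • w)) = (c : ℂ) • (w, conjVal w) := by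
          ext <;> simp [conjVal]
        ext1 v
        simp only [formSymbol, this, map_smul]
        simp)
      (fun w ξ ξ' => by
        ext1 v
        have : (fun j : Fin n => (((ξ + ξ') j : ℝ) : ℂ) • v) =
            (fun j => ((ξ j : ℝ) : ℂ) • v) + fun j => ((ξ' j : ℝ) : ℂ) • v := by
          funext j
          simp [add_smul]
        change B₀ (w, conjVal w) (fun j : Fin n => (((ξ + ξ') j : ℝ) : ℂ) • v) = _
        rw [this, map_add]
        rfl)
      (fun c w ξ => by
        ext1 v
        have : (fun j : Fin n => (((c • ξ) j : ℝ) : ℂ) • v) =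
            (c : ℂ) • fun j => ((ξ j : ℝ) : ℂ) • v := by
          funext j
          simp [mul_smul]
        change B₀ (w, conjVal w) (fun j : Fin n => (((c • ξ) j : ℝ) : ℂ) • v) = _
        rw [this, map_smul]
        simp [formSymbol]))
    ‖B₀‖ fun w ξ => norm_formSymbol_le B₀ w ξ

lemma formBilin_apply (B₀ : GradForm n m) (w : Val m) (ξ : Space n) :
    formBilin B₀ w ξ = formSymbol B₀ w ξ := rfl

/-- Multi-indices become lists, so that derivatives can be treated one at a time by induction. -/
lemma foldr_iterate {ι X : Type*} (D : ι → X → X) (α : ι → ℕ) (l : List ι) (g : X) :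
    l.foldr (fun i h => (D i)^[α i] h) g =
      (l.flatMap fun i => List.replicate (α i) i).foldr D g := by
  induction l with
  | nil => rfl
  | cons i l ih =>
    rw [List.foldr_cons, ih, List.flatMap_cons, List.foldr_append]
    generalize (l.flatMap fun i => List.replicate (α i) i).foldr D g = h
    induction α i with
    | zero => rfl
    | succ k ihk => rw [Function.iterate_succ_apply', ihk, List.replicate_succ, List.foldr_cons]

/-- The list of indices with multiplicities given by a multi-index. -/
def indexList (α : Fin n → ℕ) : List (Fin n) :=
  (List.finRange n).flatMap fun i => List.replicate (α i) i

lemma length_indexList (α : Fin n → ℕ) : (indexList α).length = ∑ i, α i := by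
  simp [indexList, List.length_flatMap, Fin.sum_univ_def]

lemma mixedDeriv_eq {G : Type*} [NormedAddCommGroup G] [NormedSpace ℝ G] (α β : Fin n → ℕ)
    (g : Space n → Space n → G) :
    mixedDeriv α β g = (indexList α).foldr partialX ((indexList β).foldr partialXi g) := by
  rw [mixedDeriv, foldr_iterate partialX, foldr_iterate partialXi]
  rfl

variable {G : Type*} [NormedAddCommGroup G] [NormedSpace ℝ G]

/-- The map `P` leaves room for every `ξ`-dependence that remains after the `ξ`-derivatives: linear,
constant or zero. -/
lemma foldr_partialX_smear {F : Type*} [NormedAddCommGroup F] [NormedSpace ℂ F] [CompleteSpace F]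
    (u : 𝓢(Space n, ℂ) →L[ℂ] F) (K : 𝓢(Space n, ℂ)) (P : Space n → F →L[ℝ] G)
    (L : List (Fin n)) :
    L.foldr partialX (fun x ξ => P ξ (smear u K x)) =
      fun x ξ => P ξ (smear u (listDeriv L K) x) := by
  induction L with
  | nil => rfl
  | cons i L ih =>
    rw [List.foldr_cons, ih]
    funext x ξ
    have h := (P ξ).hasFDerivAt.comp x (hasFDerivAt_smear u (listDeriv L K) x)
    change fderiv ℝ (fun y => P ξ (smear u (listDeriv L K) y)) x _ = _
    rw [show (fun y => P ξ (smear u (listDeriv L K) y)) = P ξ ∘ smear u (listDeriv L K) from rfl,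
      h.fderiv, ContinuousLinearMap.comp_apply, smearDeriv_apply, listDeriv_cons]

lemma partialXi_clm {W : Type*} [NormedAddCommGroup W] [NormedSpace ℝ W]
    (Λ : W →L[ℝ] Space n →L[ℝ] G) (w : Space n → W) (i : Fin n) :
    partialXi i (fun x ξ => Λ (w x) ξ) = fun x _ => Λ (w x) (EuclideanSpace.single i 1) := by
  funext x ξ
  rw [partialXi, ContinuousLinearMap.fderiv]

lemma partialXi_const (h : Space n → G) (i : Fin n) :
    partialXi i (fun x _ => h x) = fun _ _ => 0 := by
  funext x ξ
  simp [partialXi]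

lemma foldr_partialXi_clm {W : Type*} [NormedAddCommGroup W] [NormedSpace ℝ W]
    (Λ : W →L[ℝ] Space n →L[ℝ] G) (w : Space n → W) (i j : Fin n) (L : List (Fin n)) :
    (i :: j :: L).foldr partialXi (fun x ξ => Λ (w x) ξ) = fun _ _ => 0 := by
  have h : ∀ (j : Fin n) (L : List (Fin n)), ∃ h : Space n → G,
      (j :: L).foldr partialXi (fun x ξ => Λ (w x) ξ) = fun x _ => h x := by
    intro j L
    induction L generalizing j with
    | nil => exact ⟨_, partialXi_clm Λ w j⟩
    | cons k L ih =>
      obtain ⟨h, hh⟩ := ih k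
      exact ⟨fun _ => 0, by rw [List.foldr_cons, hh, partialXi_const]⟩
  obtain ⟨h, hh⟩ := h j L
  rw [List.foldr_cons, hh, partialXi_const]

end Symbol

/-! ### Change of variables along rays -/

section Lines

variable {n : ℕ}

lemma lintegral_comp_mul_Ioi {f : ℝ → ℝ≥0∞} (hf : Measurable f) {c : ℝ} (hc : 0 < c) :
    ∫⁻ t in Set.Ioi (0 : ℝ), f (c * t) = ENNReal.ofReal c⁻¹ * ∫⁻ r in Set.Ioi (0 : ℝ), f r := by
  have hm : Measurable ((Set.Ioi (0 : ℝ)).indicator f) := hf.indicator measurableSet_Ioi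
  rw [← lintegral_indicator measurableSet_Ioi, ← lintegral_indicator measurableSet_Ioi]
  have h := lintegral_map (μ := volume) hm (measurable_const_mul c)
  rw [Real.map_volume_mul_left hc.ne', lintegral_smul_measure, abs_of_pos (by positivity)] at h
  rw [smul_eq_mul] at h
  rw [h]
  refine lintegral_congr fun t => ?_
  by_cases ht : t ∈ Set.Ioi (0 : ℝ)
  · have : c * t ∈ Set.Ioi (0 : ℝ) := mul_pos hc ht
    rw [Set.indicator_of_mem ht, Set.indicator_of_mem this]
  · have : c * t ∉ Set.Ioi (0 : ℝ) := fun h => ht ((mul_pos_iff_of_pos_left hc).1 h)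
    rw [Set.indicator_of_notMem ht, Set.indicator_of_notMem this]

/-- The rescaled ray has speed `2ε‖ξ‖`, so the Jacobian supplies `ε⁻¹` and cancels `‖ξ‖`. Enlarging
the segment to the half-line makes the bound uniform in `ξ`. -/
lemma lintegral_along_ray_le {f : Space n → ℝ≥0∞} (hf : Measurable f) {S : ℝ≥0∞}
    (h : ∀ (y θ : Space n), ‖θ‖ = 1 → ∫⁻ r in Set.Ioi (0 : ℝ), f (y + r • θ) ≤ S)
    {ε : ℝ} (hε : 0 < ε) (x ξ : Space n) :
    (∫⁻ t in Set.Icc (0 : ℝ) 1, f (ε • (x + (2 * t) • ξ))) * ‖ξ‖ₑ ≤ ENNReal.ofReal ε⁻¹ * S := by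
  rcases eq_or_ne ξ 0 with rfl | hξ
  · simp
  have hn : 0 < ‖ξ‖ := norm_pos_iff.2 hξ
  set θ : Space n := ‖ξ‖⁻¹ • ξ with hθ
  have hθ1 : ‖θ‖ = 1 := by rw [hθ, norm_smul, norm_inv, norm_norm, inv_mul_cancel₀ hn.ne']
  set c : ℝ := 2 * ε * ‖ξ‖ with hc
  have hc0 : 0 < c := by positivity
  have e : ∀ t : ℝ, f (ε • (x + (2 * t) • ξ)) = f (ε • x + (c * t) • θ) := by
    intro t
    congr 1
    rw [hθ, hc, smul_add, smul_smul, smul_smul]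
    congr 2
    field_simp
  simp_rw [e]
  have h1 : ∫⁻ t in Set.Icc (0 : ℝ) 1, f (ε • x + (c * t) • θ) ≤
      ENNReal.ofReal c⁻¹ * S := by
    rw [setLIntegral_congr Ioc_ae_eq_Icc.symm]
    refine (lintegral_mono_set Set.Ioc_subset_Ioi_self).trans ?_
    rw [lintegral_comp_mul_Ioi (f := fun r => f (ε • x + r • θ)) (by fun_prop) hc0]
    gcongr
    exact h _ θ hθ1
  calc _ ≤ ENNReal.ofReal c⁻¹ * S * ‖ξ‖ₑ := by gcongr
    _ = ENNReal.ofReal (c⁻¹ * ‖ξ‖) * S := by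
        rw [ENNReal.ofReal_mul (by positivity), ofReal_norm]; ring
    _ ≤ _ := by
        gcongr
        rw [hc, mul_inv, mul_assoc, inv_mul_cancel₀ hn.ne', mul_one, mul_inv]
        exact mul_le_of_le_one_left (by positivity) (by norm_num)

end Lines

/-! ### Bounds for the rescaled low-frequency part -/

section LowFrequency

variable {n m : ℕ}

lemma enorm_smear_rescale (χ : Cutoff n) (u : 𝓢'(Space n, Val m)) {ε : ℝ} (hε : 0 < ε)
    (L : List (Fin n)) (x : Space n) :
    ‖smear (distCLM (rescale ε hε u)) (listDeriv L (χ.kernel 0)) x‖ₑ =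
      ENNReal.ofReal ε * (ENNReal.ofReal (ε ^ L.length) *
        ‖smear (distCLM u) (listDeriv L (scaled ε hε (χ.kernel 0))) (ε • x)‖ₑ) := by
  have e : ∀ a : ℝ, 0 ≤ a → ‖(a : ℂ)‖ₑ = ENNReal.ofReal a := fun a ha => by
    rw [← ofReal_norm, Complex.norm_real, Real.norm_of_nonneg ha]
  have h : smear (distCLM u) (listDeriv L (scaled ε hε (χ.kernel 0))) (ε • x) =
      (((ε⁻¹) ^ L.length : ℝ) : ℂ) •
        smear (distCLM u) (scaled ε hε (listDeriv L (χ.kernel 0))) (ε • x) := by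
    rw [listDeriv_scaled, smear, reflectAt_smul, map_smul]
    rfl
  rw [smear_rescale, enorm_smul, e ε hε.le, h, enorm_smul, e _ (by positivity), ← mul_assoc
    (ENNReal.ofReal (ε ^ L.length)), ← ENNReal.ofReal_mul (by positivity), ← mul_pow,
    mul_inv_cancel₀ hε.ne', one_pow, ENNReal.ofReal_one, one_mul]

/-- Derivatives of the rescaled low frequency part: integrals along rays, and pointwise bounds. -/
theorem exists_smear_rescale_bounds (hn : 0 < n) (χ : Cutoff n) {s ρ : ℝ} (hρ : 0 < ρ)
    (hs : (n : ℝ) / 2 + 2 * ρ ≤ s) (L : List (Fin n)) :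
    ∃ C : ℝ, 0 ≤ C ∧ ∀ {m : ℕ} (u : 𝓢'(Space n, Val m)) {ε : ℝ} (hε : 0 < ε), ε ≤ 1 →
      (∀ {σ : ℝ}, 0 ≤ σ → σ ≤ ρ → σ ≤ L.length → ∀ x ξ,
        (∫⁻ t in Set.Icc (0 : ℝ) 1, ‖smear (distCLM (rescale ε hε u))
          (listDeriv L (χ.kernel 0)) (x + (2 * t) • ξ)‖ₑ) * ‖ξ‖ₑ ≤
            ENNReal.ofReal (C * ε ^ σ) * dhNorm χ s u) ∧
      ∀ x, ‖smear (distCLM (rescale ε hε u)) (listDeriv L (χ.kernel 0)) x‖ₑ ≤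
        ENNReal.ofReal (C * ε) * dhNorm χ s u := by
  obtain ⟨C, hC, h⟩ := exists_lintegral_listDeriv_le χ hρ hs L
  refine ⟨C, hC, fun {m} u {ε} hε hε1 => ⟨fun {σ} hσ hσρ hσL x ξ => ?_, fun x => ?_⟩⟩
  · simp_rw [enorm_smear_rescale]
    set f : Space n → ℝ≥0∞ := fun y => ENNReal.ofReal (ε ^ L.length) *
      ‖smear (distCLM u) (listDeriv L (scaled ε hε (χ.kernel 0))) y‖ₑ with hf
    have hsm := (continuous_smear (distCLM u)
      (listDeriv L (scaled ε hε (χ.kernel 0)))).measurable.enorm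
    have hfm : Measurable f := hsm.const_mul _
    have h1 := lintegral_along_ray_le hfm (fun y θ hθ => by
      have h2 := h u (admissible_halfLine hθ) hε hε1 hσ hσρ hσL y
      rwa [← lintegral_const_mul' _ _ ENNReal.ofReal_ne_top] at h2) hε x ξ
    rw [lintegral_const_mul' _ _ ENNReal.ofReal_ne_top, mul_assoc]
    refine (mul_le_mul_right h1 _).trans_eq ?_
    -- The amplitude `ε` of the rescaling cancels the `ε⁻¹` of the Jacobian.
    rw [← mul_assoc, ← ENNReal.ofReal_mul hε.le, mul_inv_cancel₀ hε.ne', ENNReal.ofReal_one,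
      one_mul]
  · have hθ : ‖(EuclideanSpace.single (⟨0, hn⟩ : Fin n) (1 : ℝ) : Space n)‖ = 1 := by simp
    -- Here `σ = 0`: without a Jacobian the amplitude `ε` survives and already provides the
    -- smallness.
    have h1 := h u (admissible_dirac hθ) hε hε1 le_rfl hρ.le (Nat.cast_nonneg _) (ε • x)
    rw [lintegral_dirac, add_zero, Real.rpow_zero, mul_one] at h1
    rw [enorm_smear_rescale, mul_comm C, ENNReal.ofReal_mul hε.le, mul_assoc]
    gcongr

end LowFrequency

/-! ### Membership in the symbol class -/

section Main

variable {n m : ℕ}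

lemma lowSymbol_eq (χ : Cutoff n) (B₀ : GradForm n m) (ε : ℝ) (hε : 0 < ε)
    (u : 𝓢'(Space n, Val m)) :
    lowSymbol χ B₀ ε hε u = fun x ξ =>
      formBilin B₀ (smear (distCLM (rescale ε hε u)) (χ.kernel 0) x) ξ := rfl

lemma enorm_formBilin_le (B₀ : GradForm n m) (w : Val m) (ξ : Space n) :
    ‖formBilin B₀ w ξ‖ₑ ≤ ENNReal.ofReal ‖B₀‖ * (‖w‖ₑ * ‖ξ‖ₑ) := by
  have hB : 0 ≤ ‖B₀‖ := norm_nonneg B₀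
  rw [formBilin_apply, ← ofReal_norm, ← ofReal_norm w, ← ofReal_norm ξ,
    ← ENNReal.ofReal_mul (norm_nonneg _), ← ENNReal.ofReal_mul hB, ← mul_assoc]
  exact ENNReal.ofReal_le_ofReal (norm_formSymbol_le B₀ w ξ)

lemma contDiff_lowSymbol (χ : Cutoff n) (B₀ : GradForm n m) (ε : ℝ) (hε : 0 < ε)
    (u : 𝓢'(Space n, Val m)) :
    ContDiff ℝ ∞ fun p : Space n × Space n => lowSymbol χ B₀ ε hε u p.1 p.2 := by
  simp only [lowSymbol_eq]
  exact ((formBilin B₀).contDiff.comp ((contDiff_smear _ _).comp contDiff_fst)).clm_apply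
    contDiff_snd

lemma lintegral_formBilin_le (B₀ : GradForm n m) (w : Space n → Val m) {S : ℝ≥0∞} {x ξ : Space n}
    (h : (∫⁻ t in Set.Icc (0 : ℝ) 1, ‖w (x + (2 * t) • ξ)‖ₑ) * ‖ξ‖ₑ ≤ S) :
    ∫⁻ t in Set.Icc (0 : ℝ) 1, ‖formBilin B₀ (w (x + (2 * t) • ξ)) ξ‖ₑ ≤
      ENNReal.ofReal ‖B₀‖ * S := by
  refine (lintegral_mono fun t => enorm_formBilin_le B₀ _ ξ).trans ?_
  rw [lintegral_const_mul' _ _ ENNReal.ofReal_ne_top, lintegral_mul_const' _ _ enorm_ne_top]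
  gcongr

/-- The smallness of `ε` absorbs the exponential of the size of the data. -/
lemma smallness {b M c σ κ ε C : ℝ} (hb : 0 ≤ b) (hM : 0 ≤ M) (hσ : 0 < σ) (hκ : 0 < κ)
    (hε : 0 < ε) (hC : (c * b + b / κ) / σ ≤ C) (hle : ε ≤ Real.exp (-C * M)) :
    b * M * ε ^ σ * Real.exp (c * b * M) ≤ κ := by
  -- The exponent has two parts: `c * b` cancels the exponential of the symbol bound, and `b / κ`
  -- absorbs the factor `b * M`, because `t ≤ e^t`.
  have h1 : ε ^ σ ≤ Real.exp (-(c * b + b / κ) * M) := by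
    refine (Real.rpow_le_rpow hε.le hle hσ.le).trans ?_
    rw [← Real.exp_mul]
    refine Real.exp_le_exp.2 ?_
    rw [div_le_iff₀ hσ] at hC
    nlinarith
  have h2 : b * M * Real.exp (-(b * M / κ)) ≤ κ := by
    have h3 : b * M / κ ≤ Real.exp (b * M / κ) := by
      linarith [Real.add_one_le_exp (b * M / κ)]
    rw [Real.exp_neg, ← div_eq_mul_inv, div_le_iff₀ (Real.exp_pos _)]
    rwa [div_le_iff₀' hκ] at h3
  calc b * M * ε ^ σ * Real.exp (c * b * M)
      ≤ b * M * Real.exp (-(c * b + b / κ) * M) * Real.exp (c * b * M) := by gcongr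
    _ = b * M * Real.exp (-(b * M / κ)) := by
        rw [mul_assoc, ← Real.exp_add]
        congr 2
        ring
    _ ≤ κ := h2

/-- Bounds for all the derivatives of the symbol. -/
lemma lintegral_mixedDeriv_le (χ : Cutoff n) (B₀ : GradForm n m) {s ρ : ℝ}
    (u : 𝓢'(Space n, Val m)) {ε : ℝ} (hε : 0 < ε) (hε1 : ε ≤ 1) (hρ : 0 < ρ) {Cst : ℝ}
    (hC : 0 ≤ Cst) (α β : Fin n → ℕ) (hαβ : 1 ≤ ∑ i, α i + ∑ i, β i)
    (hline : ∀ {σ : ℝ}, 0 ≤ σ → σ ≤ ρ → σ ≤ (indexList α).length → ∀ x ξ,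
      (∫⁻ t in Set.Icc (0 : ℝ) 1, ‖smear (distCLM (rescale ε hε u))
        (listDeriv (indexList α) (χ.kernel 0)) (x + (2 * t) • ξ)‖ₑ) * ‖ξ‖ₑ ≤
          ENNReal.ofReal (Cst * ε ^ σ) * dhNorm χ s u)
    (hpt : ∀ x, ‖smear (distCLM (rescale ε hε u)) (listDeriv (indexList α) (χ.kernel 0)) x‖ₑ ≤
      ENNReal.ofReal (Cst * ε) * dhNorm χ s u) (x ξ : Space n) :
    ∫⁻ t in Set.Icc (0 : ℝ) 1,
      ‖mixedDeriv α β (lowSymbol χ B₀ ε hε u) (x + (2 * t) • ξ) ξ‖ₑ ≤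
        ENNReal.ofReal ‖B₀‖ * (ENNReal.ofReal (Cst * ε ^ min 1 ρ) * dhNorm χ s u) := by
  rw [mixedDeriv_eq, lowSymbol_eq]
  have hα := length_indexList α
  have hβ := length_indexList β
  match hL : indexList β with
  | [] =>
    have e := foldr_partialX_smear (distCLM (rescale ε hε u)) (χ.kernel 0)
      (fun ξ => (formBilin B₀).flip ξ) (indexList α)
    simp only [ContinuousLinearMap.flip_apply] at e
    rw [List.foldr_nil, e]
    refine lintegral_formBilin_le B₀ _ (hline (by positivity) (min_le_right _ _) ?_ x ξ)
    rw [hL, List.length_nil] at hβ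
    rw [hα]
    have : 1 ≤ ∑ i, α i := by omega
    exact (min_le_left _ _).trans (by exact_mod_cast this)
  -- The factor `ξ` is gone, so the ray estimate is not available; the pointwise bound is integrated
  -- over unit time, and `ε ≤ ε ^ min 1 ρ`.
  | [i] =>
    rw [List.foldr_cons, List.foldr_nil, partialXi_clm]
    have e := foldr_partialX_smear (distCLM (rescale ε hε u)) (χ.kernel 0)
      (fun _ => (formBilin B₀).flip (EuclideanSpace.single i 1)) (indexList α)
    simp only [ContinuousLinearMap.flip_apply] at e
    rw [e]
    have hεσ : ε ≤ ε ^ min 1 ρ := by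
      simpa using Real.rpow_le_rpow_of_exponent_ge hε hε1 (min_le_left 1 ρ)
    have hb : ∀ y, ‖formBilin B₀ (smear (distCLM (rescale ε hε u))
        (listDeriv (indexList α) (χ.kernel 0)) y) (EuclideanSpace.single i 1)‖ₑ ≤
        ENNReal.ofReal ‖B₀‖ * (ENNReal.ofReal (Cst * ε ^ min 1 ρ) * dhNorm χ s u) := fun y => by
      refine (enorm_formBilin_le B₀ _ _).trans ?_
      have h1 : ‖(EuclideanSpace.single i 1 : Space n)‖ₑ = 1 := by
        rw [← ofReal_norm]; simp
      rw [h1, mul_one]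
      gcongr
      exact (hpt y).trans (by gcongr)
    refine (lintegral_mono fun t => hb _).trans ?_
    simp
  | i :: j :: L =>
    rw [foldr_partialXi_clm]
    have e := foldr_partialX_smear (distCLM (rescale ε hε u)) (χ.kernel 0)
      (fun _ => (0 : Val m →L[ℝ] (Val m →L[ℂ] Val m))) (indexList α)
    simp only [zero_apply] at e
    rw [e]
    have h0 : ‖(0 : Val m →L[ℂ] Val m)‖ₑ = 0 := by
      rw [← ofReal_norm, ContinuousLinearMap.opNorm_zero, ENNReal.ofReal_zero]
    exact (lintegral_mono fun t => h0.le).trans (by simp)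

end Main

end DerivNLS

end

open DerivNLS

theorem mainTheorem6 (n : ℕ) (hn : 2 ≤ n) (s : ℝ) (hs : (n : ℝ) / 2 < s)
    (χ : DerivNLS.Cutoff n) :
    ∃ (c : ℝ) (K : (Fin n → ℕ) → (Fin n → ℕ) → ℝ), 0 < c ∧
      ∀ (m : ℕ) (B₀ : DerivNLS.GradForm n m) (κ : ℝ), 0 < κ →
        ∃ C : ℝ, 0 < C ∧
          ∀ u₀ : TemperedDistribution (DerivNLS.Space n) (DerivNLS.Val m),
            DerivNLS.MemDH χ s u₀ →
            ∀ (ε : ℝ) (hε : 0 < ε),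
              ε ≤ Real.exp (-C * (DerivNLS.dhNorm χ s u₀).toReal) →
              DerivNLS.InClass K κ (c * ‖B₀‖ * (DerivNLS.dhNorm χ s u₀).toReal)
                (fun _ : ℝ => DerivNLS.lowSymbol χ B₀ ε hε u₀) := by
  -- Half of the surplus regularity: one half gives the power of `ε`, the other the convergence of
  -- the dyadic sum.
  set ρ : ℝ := (s - n / 2) / 2 with hρ_def
  have hρ : 0 < ρ := by rw [hρ_def]; linarith
  have hsρ : (n : ℝ) / 2 + 2 * ρ ≤ s := by rw [hρ_def]; linarith
  choose Cst hCst hbounds using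
    fun L : List (Fin n) => exists_smear_rescale_bounds (by omega) χ hρ hsρ L
  have hσ : 0 < min 1 ρ := lt_min one_pos hρ
  refine ⟨Cst [] + 1, fun α _ => Cst (indexList α), by linarith [hCst []],
    fun m B₀ κ hκ => ?_⟩
  -- The quotient is what `smallness` requires with `c = Cst [] + 1`; the added `1` keeps the
  -- constant positive when `B₀ = 0`.
  refine ⟨(((Cst [] + 1) * ‖B₀‖ + ‖B₀‖ / κ) / min 1 ρ) + 1, ?_, fun u₀ hu₀ ε hε hle => ?_⟩
  · have := hCst []
    positivity
  have hB : 0 ≤ ‖B₀‖ := norm_nonneg B₀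
  set M : ℝ := (dhNorm χ s u₀).toReal with hM
  have hM0 : 0 ≤ M := ENNReal.toReal_nonneg
  have hdh : dhNorm χ s u₀ = ENNReal.ofReal M := (ENNReal.ofReal_toReal hu₀.ne).symm
  have hε1 : ε ≤ 1 := by
    refine hle.trans (Real.exp_le_one_iff.2 ?_)
    have := hCst []
    rw [neg_mul, neg_nonpos]
    positivity
  refine ⟨fun x ξ => stronglyMeasurable_const, fun _ => contDiff_lowSymbol χ B₀ ε hε u₀,
    fun x ξ => ?_, ‖B₀‖ * M * ε ^ min 1 ρ, by positivity,
    smallness hB hM0 hσ hκ hε (by linarith) hle, fun α β hαβ x ξ => ?_⟩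
  -- The undifferentiated symbol uses the empty list and `σ = 0`: no gain in `ε`, hence a bound of
  -- size `M`.
  · have h := lintegral_formBilin_le B₀ _
      ((hbounds [] u₀ hε hε1).1 le_rfl hρ.le (Nat.cast_nonneg _) x ξ)
    refine h.trans ?_
    rw [hdh, Real.rpow_zero, mul_one, ← ENNReal.ofReal_mul (hCst []),
      ← ENNReal.ofReal_mul hB]
    refine ENNReal.ofReal_le_ofReal ?_
    have := mul_nonneg hB hM0
    nlinarith
  · obtain ⟨h1, h2⟩ := hbounds (indexList α) u₀ hε hε1
    refine (lintegral_mixedDeriv_le χ B₀ u₀ hε hε1 hρ (hCst _) α β hαβ h1 h2 x ξ).trans_eq ?_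
    have := hCst (indexList α)
    rw [hdh, ← ENNReal.ofReal_mul (by positivity), ← ENNReal.ofReal_mul hB]
    congr 1
    ring
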